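/- **Theorem 3.1.** Let $\log$ and all powers be principal, with $\arg\in(-\pi,\pi]$. Let $\Phi(z,s,b)$ be the Hurwitz–Lerch zeta function: $\Phi(z,s,b)=\sum_{n\ge 0} z^n/(b+n)^s$ for $|z|<1$, continued analytically in $z$ to $\mathbb C\setminus[1,\infty)$; and $\Phi(1,s,b)=\zeta(s,b)$ is the Hurwitz zeta function, that is, $\sum_{n\ge0}(b+n)^{-s}$ for $\operatorname{Re}s>1$, continued analytically in $s$ to $s\ne 1$. Let $m,k,a\in\mathbb C$ with $a\neq 0$ satisfy: * $-1<\operatorname{Re} m<5$; if $\operatorname{Re} m\in\{1,3\}$, then $\operatorname{Im} m\ge 0$ (so that $-e^{im\pi}\notin(1,\infty)$); and if $m\in\{1,3\}$, then $k\notin\{0,1\}$ and $a\ne -i$; * either $k\in\{0,1,2,\dots\}$, or $0<\arg a\le\pi$, or $a>0$ and $\operatorname{Re}k>-1$. Then the integral below converges absolutely and $$\int_0^\infty \frac{x^m\log^k(ax)}{(x^2+1)^3}\,dx=\frac18\,\pi^{k-1}e^{\frac12 i\pi(k+m)}\Big(-2i\pi k(m-2)\,\Phi\big(-e^{im\pi},1-k,b\big)-(k-1)k\,\Phi\big(-e^{im\pi},2-k,b\big)+\pi^2(m-3)(m-1)\,\Phi\big(-e^{im\pi},-k,b\big)\Big),$$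 where $b=\frac12-\frac{i\log a}{\pi}$, and a term whose polynomial coefficient in $k$ and $m$ vanishes is read as $0$. -/

import Mathlib

open MeasureTheory Set

noncomputable section

/-- The `n`-th term `zⁿ / (b + n)ˢ` of the Hurwitz–Lerch series (principal powers). -/
def lerchTerm (z s b : ℂ) (n : ℕ) : ℂ := z ^ n * (b + n) ^ (-s)

/-- `f` is holomorphic on `ℂ ∖ [1, ∞)` and is given by the Hurwitz–Lerch series
`∑ zⁿ / (b + n)ˢ` on the open unit disc. Since `ℂ ∖ [1, ∞)` is connected, `f` is determined on it.
(`1 - z ∈ Complex.slitPlane` says that `z` is not a real number `≥ 1`.) -/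
def IsLerchContinuation (s b : ℂ) (f : ℂ → ℂ) : Prop :=
  DifferentiableOn ℂ f {z : ℂ | 1 - z ∈ Complex.slitPlane} ∧
    ∀ z : ℂ, ‖z‖ < 1 → HasSum (lerchTerm z s b) (f z)

/-- `g` is holomorphic on `ℂ ∖ {1}` and is given by the Hurwitz zeta series
`∑ 1 / (b + n)ˢ`, the Hurwitz–Lerch series at `z = 1`, on the half plane `Re s > 1`. -/
def IsHurwitzContinuation (b : ℂ) (g : ℂ → ℂ) : Prop :=
  DifferentiableOn ℂ g {1}ᶜ ∧
    ∀ s : ℂ, 1 < s.re → HasSum (lerchTerm 1 s b) (g s)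

open Classical in
/-- The Hurwitz–Lerch zeta function `Φ(z, s, b)`: on `ℂ ∖ [1, ∞)` it is the analytic continuation
in `z` of `∑ zⁿ / (b + n)ˢ`; at `z = 1` it is the Hurwitz zeta function `ζ(s, b)`, continued
analytically in `s` to `s ≠ 1`. (The value on the cut `z > 1` is irrelevant.) -/
def lerchPhi (z s b : ℂ) : ℂ :=
  if z = 1 then Classical.epsilon (IsHurwitzContinuation b) s
  else if 1 - z ∈ Complex.slitPlane then Classical.epsilon (IsLerchContinuation s b) z
  else 0

/-- The integrand `x ^ m * log(a x) ^ k / (x² + 1)³`, with principal logarithm and powers. -/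
def logIntegrand (m k a : ℂ) (x : ℝ) : ℂ :=
  (x : ℂ) ^ m * Complex.log (a * x) ^ k / ((x : ℂ) ^ 2 + 1) ^ 3

end

/-! ### Bounds for `cosh`, shifting of horizontal lines, holomorphy of parameter integrals. -/

section LineIntegrals

open Filter Topology Complex

/-! The substitution `x = e^u` turns the integral into `(iπ)^k / 8` times the integral of `e^(pu)
B(u)^k / cosh³ u` over the real line. Here `p = m - 2`, and `B(z) = b - 1/2 - iz/π` is the affine
function with `iπ B(z) = log a + z`; it equals `b + n` at the zero `(n + 1/2)πi` of `cosh`. No zero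
of `cosh` lies between the real line and the line of height `π/4`, so the integral may be taken on
the latter, near which `B^k` is holomorphic (`integral_real_line_eq`).

Translation by `πi` changes the sign of `cosh` and crosses exactly one of its zeros. Repeating it
shows that the integral of `e^(pz) h / cosh` along that line is `2π e^(iπp/2) ∑ (-e^(iπp))^n h((n +
1/2)πi)` when `|Re p| < 1` and `Im p > 0`. For `h = B^κ` this is a Lerch series. The integral is
holomorphic in the whole strip `|Re p| < 1`, so it also provides the continuation of the series to
`ℂ ∖ [1, ∞)` (`UpperSubexp.exists_lerch_continuation`).

Two integrations by parts express the integral with `cosh³` through integrals with `cosh` and `h`,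
`h'`, `h''` (`two_mul_coshIntegral_three`). Each derivative lowers the exponent of `B` by one,
whence the three Lerch values. The integral with `cosh³` is holomorphic for `|Re p| < 3`, and the
identity theorem extends the formula there, off two half lines (`coshIntegral_three_eq`).

At `p = ±1`, that is `m = 1, 3`, the argument `-e^(iπp)` is `1`. There a single integration by parts
leads to `cosh²` (`coshIntegral_three_of_sq_eq_one`), and the double poles turn the integral of `B^κ
/ cosh²` into a Hurwitz zeta value (`coshIntegral_two_lerchPow_eq`). -/

theorem Complex.norm_cosh_add_mul_I_sq (u y : ℝ) :
    ‖cosh (u + y * I)‖ ^ 2 = Real.sinh u ^ 2 + Real.cos y ^ 2 := by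
  have h : cosh (u + y * I) =
      ((Real.cosh u * Real.cos y : ℝ) : ℂ) + ((Real.sinh u * Real.sin y : ℝ) : ℂ) * I := by
    rw [cosh_add, cosh_mul_I, sinh_mul_I]; push_cast; ring
  rw [h, ← normSq_eq_norm_sq, normSq_add_mul_I]
  nlinarith [Real.sin_sq_add_cos_sq y, Real.cosh_sq u]

theorem Complex.abs_sinh_le_norm_cosh (u y : ℝ) : |Real.sinh u| ≤ ‖cosh (u + y * I)‖ := by
  refine abs_le_of_sq_le_sq ?_ (norm_nonneg _)
  rw [norm_cosh_add_mul_I_sq]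
  nlinarith [sq_nonneg (Real.cos y)]

theorem Complex.abs_cos_mul_cosh_le_norm_cosh (u y : ℝ) :
    |Real.cos y| * Real.cosh u ≤ ‖cosh (u + y * I)‖ := by
  refine le_of_sq_le_sq ?_ (norm_nonneg _)
  rw [norm_cosh_add_mul_I_sq, mul_pow, sq_abs, Real.cosh_sq]
  nlinarith [Real.cos_sq_le_one y, sq_nonneg (Real.sinh u)]

theorem Real.exp_abs_le_two_mul_cosh (u : ℝ) : Real.exp |u| ≤ 2 * Real.cosh u := by
  rw [Real.cosh_eq]
  rcases abs_cases u with h | h <;> rw [h.1] <;>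
    nlinarith [Real.exp_pos u, Real.exp_pos (-u)]

theorem Complex.norm_inv_cosh_le {y : ℝ} (hy : Real.cos y ≠ 0) (u : ℝ) :
    ‖(cosh (u + y * I))⁻¹‖ ≤ 2 / |Real.cos y| * Real.exp (-|u|) := by
  have hc : 0 < |Real.cos y| := abs_pos.2 hy
  rw [norm_inv, Real.exp_neg, ← div_eq_mul_inv, div_div, ← one_div,
    div_le_div_iff₀ (lt_of_lt_of_le (by positivity) (abs_cos_mul_cosh_le_norm_cosh u y))
    (by positivity)]
  nlinarith [abs_cos_mul_cosh_le_norm_cosh u y, Real.exp_abs_le_two_mul_cosh u]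

theorem Complex.cosh_add_mul_I_ne_zero {y : ℝ} (hy : Real.cos y ≠ 0) (u : ℝ) :
    cosh (u + y * I) ≠ 0 := by
  intro h
  have := abs_cos_mul_cosh_le_norm_cosh u y
  rw [h, norm_zero] at this
  have : 0 < |Real.cos y| * Real.cosh u := mul_pos (abs_pos.2 hy) (Real.cosh_pos u)
  linarith

theorem integrable_exp_neg_mul_abs {β : ℝ} (hβ : 0 < β) :
    Integrable fun u : ℝ => Real.exp (-(β * |u|)) := by
  rw [← integrableOn_univ, ← Iic_union_Ioi (a := (0 : ℝ))]
  refine IntegrableOn.union ?_ ?_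
  · refine (integrableOn_exp_mul_Iic hβ 0).congr_fun (fun u hu => ?_) measurableSet_Iic
    simp only [abs_of_nonpos (mem_Iic.1 hu), mul_neg, neg_neg]
  · refine (integrableOn_exp_mul_Ioi (neg_lt_zero.2 hβ) 0).congr_fun (fun u hu => ?_)
      measurableSet_Ioi
    simp only [abs_of_pos (mem_Ioi.1 hu), neg_mul]

/-- Cauchy's theorem on the rectangle `[-R, R] × [y₁, y₂]`; the bound `B R` makes the two vertical
sides vanish as `R → ∞`. -/
theorem integral_line_eq_of_differentiableOn {f : ℂ → ℂ} {y₁ y₂ : ℝ} (hy : y₁ ≤ y₂)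
    (hd : DifferentiableOn ℂ f {z | z.im ∈ Icc y₁ y₂})
    (h₁ : Integrable fun u : ℝ => f (u + y₁ * I)) (h₂ : Integrable fun u : ℝ => f (u + y₂ * I))
    {B : ℝ → ℝ} (hB : Tendsto B atTop (𝓝 0))
    (hfB : ∀ᶠ R in atTop, ∀ u : ℝ, |u| = R → ∀ y ∈ Icc y₁ y₂, ‖f (u + y * I)‖ ≤ B R) :
    ∫ u : ℝ, f (u + y₁ * I) = ∫ u : ℝ, f (u + y₂ * I) := by
  have key : ∀ R : ℝ, 0 ≤ R → (∫ u in (-R)..R, f (u + y₁ * I)) - ∫ u in (-R)..R, f (u + y₂ * I) =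
      I • (∫ y in y₁..y₂, f ((-R : ℝ) + y * I)) - I • ∫ y in y₁..y₂, f (R + y * I) := by
    intro R hR
    have := integral_boundary_rect_eq_zero_of_differentiableOn f ((-R : ℝ) + y₁ * I) (R + y₂ * I)
      (hd.mono ?_)
    · simp only [add_re, ofReal_re, mul_re, I_re, I_im, ofReal_im, add_im, mul_im, mul_zero,
        mul_one, sub_zero, add_zero, zero_add] at this
      linear_combination (norm := skip) this
      simp only [smul_eq_mul]
      ring
    · intro z hz
      have := hz.2
      simp only [add_im, ofReal_im, mul_im, ofReal_re, I_im, I_re, mul_one, mul_zero, zero_add,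
        add_zero, mem_preimage, uIcc_of_le hy] at this
      exact this
  have l₁ := intervalIntegral_tendsto_integral h₁ tendsto_neg_atTop_atBot tendsto_id
  have l₂ := intervalIntegral_tendsto_integral h₂ tendsto_neg_atTop_atBot tendsto_id
  have l₃ : Tendsto (fun R : ℝ => (∫ u in (-R)..R, f (u + y₁ * I)) -
      ∫ u in (-R)..R, f (u + y₂ * I)) atTop (𝓝 0) := by
    refine squeeze_zero_norm' (a := fun R => 2 * (B R * |y₂ - y₁|)) ?_ ?_
    · filter_upwards [hfB, eventually_ge_atTop 0] with R hR hR0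
      rw [key R hR0]
      have e : ∀ u : ℝ, |u| = R → ‖I • ∫ y in y₁..y₂, f (u + y * I)‖ ≤ B R * |y₂ - y₁| := by
        intro u hu
        rw [norm_smul, norm_I, one_mul]
        refine intervalIntegral.norm_integral_le_of_norm_le_const fun y hy' => hR u hu y ?_
        rw [uIoc_of_le hy] at hy'
        exact Ioc_subset_Icc_self hy'
      refine (norm_sub_le _ _).trans ?_
      linarith [e R (abs_of_nonneg hR0), e (-R) (by rw [abs_neg, abs_of_nonneg hR0])]
    · simpa using (hB.mul_const |y₂ - y₁|).const_mul 2
  exact sub_eq_zero.1 (tendsto_nhds_unique (l₁.sub l₂) l₃)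

/-- For holomorphic integrands a dominating function for `F` suffices: Cauchy's estimate on discs of
radius `r / 4` about points of the half ball dominates the derivative. -/
theorem differentiableAt_integral_of_locally_dominated {α : Type*} [MeasurableSpace α] {μ : Measure α}
    {F : ℂ → α → ℂ} {z₀ : ℂ} {r : ℝ} (hr : 0 < r)
    (hm : ∀ z ∈ Metric.ball z₀ r, AEStronglyMeasurable (F z) μ)
    (hd : ∀ x, DifferentiableOn ℂ (fun z => F z x) (Metric.ball z₀ r))
    {B : α → ℝ} (hB : Integrable B μ) (hFB : ∀ x, ∀ z ∈ Metric.ball z₀ r, ‖F z x‖ ≤ B x) :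
    DifferentiableAt ℂ (fun z => ∫ x, F z x ∂μ) z₀ := by
  have hz₀ : z₀ ∈ Metric.ball z₀ r := Metric.mem_ball_self hr
  have hda : ∀ x, ∀ z ∈ Metric.ball z₀ r, HasDerivAt (fun z => F z x) (deriv (fun z => F z x) z) z :=
    fun x z hz => ((hd x).differentiableAt (Metric.isOpen_ball.mem_nhds hz)).hasDerivAt
  refine (hasDerivAt_integral_of_dominated_loc_of_deriv_le (F' := fun z x => deriv (fun z => F z x) z)
    (s := Metric.ball z₀ (r / 2)) (bound := fun x => B x / (r / 4))
    (Metric.ball_mem_nhds _ (half_pos hr)) ?_ ?_ ?_ ?_ (hB.div_const _) ?_).2.differentiableAt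
  · filter_upwards [Metric.ball_mem_nhds z₀ hr] with z hz using hm z hz
  · exact hB.mono' (hm z₀ hz₀) (Eventually.of_forall fun x => hFB x z₀ hz₀)
  -- The derivative at `z₀` is measurable in `x` as a limit of difference quotients along a sequence
  -- of increments tending to `0`.
  · set v : ℕ → ℂ := fun n => ((r / 2 * (1 / ((n : ℝ) + 1)) : ℝ) : ℂ) with hv
    have hvpos : ∀ n : ℕ, 0 < r / 2 * (1 / ((n : ℝ) + 1)) := fun n => by positivity
    have hvn : ∀ n, v n ≠ 0 := fun n => ofReal_ne_zero.2 (hvpos n).ne'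
    have hvm : ∀ n, z₀ + v n ∈ Metric.ball z₀ r := fun n => by
      rw [Metric.mem_ball, dist_eq_norm, add_sub_cancel_left, norm_real, Real.norm_eq_abs,
        abs_of_pos (hvpos n)]
      have : 1 / ((n : ℝ) + 1) ≤ 1 := by
        rw [div_le_one (by positivity)]; linarith [(Nat.cast_nonneg n : (0 : ℝ) ≤ n)]
      nlinarith
    have hv0 : Tendsto v atTop (𝓝 0) := by
      have := (tendsto_one_div_add_atTop_nhds_zero_nat (𝕜 := ℝ)).const_mul (r / 2)
      rw [mul_zero] at this
      exact ((continuous_ofReal.tendsto 0).comp this).congr fun n => rfl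
    refine aestronglyMeasurable_of_tendsto_ae atTop
      (f := fun n x => (v n)⁻¹ • (F (z₀ + v n) x - F z₀ x)) (fun n => ?_)
      (Eventually.of_forall fun x => ?_)
    · exact ((hm _ (hvm n)).sub (hm _ hz₀)).const_smul (v n)⁻¹
    · exact ((hasDerivAt_iff_tendsto_slope_zero.1 (hda x z₀ hz₀))).comp
        (tendsto_nhdsWithin_iff.2 ⟨hv0, Eventually.of_forall hvn⟩)
  · refine Eventually.of_forall fun x z hz => ?_
    have hs : Metric.closedBall z (r / 4) ⊆ Metric.ball z₀ r := fun w hw => by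
      rw [Metric.mem_ball] at *
      rw [Metric.mem_closedBall] at hw
      linarith [dist_triangle w z z₀]
    refine norm_deriv_le_of_forall_mem_sphere_norm_le (by positivity) ?_ fun w hw =>
      hFB x w (hs (Metric.sphere_subset_closedBall hw))
    exact DifferentiableOn.diffContOnCl (((hd x).mono hs).mono Metric.closure_ball_subset_closedBall)
  · exact Eventually.of_forall fun x z hz =>
      hda x z (Metric.ball_subset_ball (by linarith) hz)

end LineIntegrals

/-! ### Residue relations for integrals against `1 / cosh` and `1 / cosh²`. -/

section CoshIntegral

open Filter Topology Complex

/-- The integral of `h / coshⁿ` along the horizontal line of height `π / 4`. -/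
noncomputable def coshIntegral (n : ℕ) (h : ℂ → ℂ) : ℂ :=
  ∫ u : ℝ, h (u + (Real.pi / 4 : ℝ) * I) * (cosh (u + (Real.pi / 4 : ℝ) * I))⁻¹ ^ n

/-- The regularisation of `(h z - h (iπ/2)) / cosh z` at the zero `iπ/2` of `cosh`. -/
noncomputable def coshQuot (h : ℂ → ℂ) (z : ℂ) : ℂ :=
  dslope h (Real.pi / 2 * I) z / dslope cosh (Real.pi / 2 * I) z

theorem Real.cos_pi_div_four_ne_zero : Real.cos (Real.pi / 4) ≠ 0 := by
  rw [Real.cos_pi_div_four]; positivity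

theorem Complex.cosh_pi_div_two_mul_I : cosh (Real.pi / 2 * I) = 0 := by
  rw [cosh_mul_I, cos_pi_div_two]

theorem Complex.sinh_pi_div_two_mul_I : sinh (Real.pi / 2 * I) = I := by
  rw [sinh_mul_I, sin_pi_div_two, one_mul]

theorem Complex.cosh_ne_zero_of_strip {z : ℂ} (h₀ : 0 < z.im) (h₁ : z.im < 3 * Real.pi / 2)
    (hz : z ≠ Real.pi / 2 * I) : cosh z ≠ 0 := by
  intro h
  have := norm_cosh_add_mul_I_sq z.re z.im
  rw [re_add_im, h, norm_zero] at this
  have hs : Real.sinh z.re = 0 := by nlinarith [sq_nonneg (Real.sinh z.re), sq_nonneg (Real.cos z.im)]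
  have hc : Real.cos z.im = 0 := by nlinarith [sq_nonneg (Real.sinh z.re), sq_nonneg (Real.cos z.im)]
  rw [Real.sinh_eq_zero] at hs
  obtain ⟨k, hk⟩ := Real.cos_eq_zero_iff.1 hc
  have hk0 : k = 0 := by
    rw [hk] at h₀ h₁
    have hp := Real.pi_pos
    have a : (-1 : ℝ) < k := by nlinarith
    have b : (k : ℝ) < 1 := by nlinarith
    norm_cast at a b
    have a' : -1 < k := by exact_mod_cast a
    omega
  apply hz
  apply Complex.ext
  · simp [hs]
  · simp [hk, hk0]

theorem coshQuot_of_ne (h : ℂ → ℂ) {z : ℂ} (hz : z ≠ Real.pi / 2 * I) :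
    coshQuot h z = (h z - h (Real.pi / 2 * I)) * (cosh z)⁻¹ := by
  have : z - Real.pi / 2 * I ≠ 0 := sub_ne_zero.2 hz
  rw [coshQuot, dslope_of_ne _ hz, dslope_of_ne _ hz, slope_def_field, slope_def_field,
    cosh_pi_div_two_mul_I, sub_zero, div_div_div_cancel_right₀ this, div_eq_mul_inv]

theorem coshQuot_self (h : ℂ → ℂ) :
    coshQuot h (Real.pi / 2 * I) = -I * deriv h (Real.pi / 2 * I) := by
  rw [coshQuot, dslope_same, dslope_same, Complex.deriv_cosh, sinh_pi_div_two_mul_I, div_I]; ring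

theorem isOpen_strip (a b : ℝ) : IsOpen {z : ℂ | a < z.im ∧ z.im < b} :=
  (isOpen_lt continuous_const continuous_im).inter (isOpen_lt continuous_im continuous_const)

theorem pi_div_two_mul_I_im : ((Real.pi / 2 * I : ℂ)).im = Real.pi / 2 := by simp

/-- Both divided differences are holomorphic, and the one of `cosh` has no zero in the strip: its
value at `iπ/2` is `sinh (iπ/2) = i`. -/
theorem differentiableOn_coshQuot {h : ℂ → ℂ}
    (hd : DifferentiableOn ℂ h {z | 0 < z.im ∧ z.im < 3 * Real.pi / 2}) :
    DifferentiableOn ℂ (coshQuot h) {z | 0 < z.im ∧ z.im < 3 * Real.pi / 2} := by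
  have hm : {z : ℂ | 0 < z.im ∧ z.im < 3 * Real.pi / 2} ∈ 𝓝 (Real.pi / 2 * I : ℂ) := by
    refine (isOpen_strip 0 _).mem_nhds ⟨?_, ?_⟩ <;> rw [pi_div_two_mul_I_im] <;>
      linarith [Real.pi_pos]
  refine ((differentiableOn_dslope hm).2 hd).div
    ((differentiableOn_dslope hm).2 differentiable_cosh.differentiableOn) fun z hz => ?_
  by_cases h0 : z = Real.pi / 2 * I
  · rw [h0, dslope_same, Complex.deriv_cosh, sinh_pi_div_two_mul_I]; exact I_ne_zero
  · rw [dslope_of_ne _ h0, slope_def_field, cosh_pi_div_two_mul_I, sub_zero]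
    exact div_ne_zero (cosh_ne_zero_of_strip hz.1 hz.2 h0) (sub_ne_zero.2 h0)

theorem continuous_line_comp {h : ℂ → ℂ} {S : Set ℂ} (hS : IsOpen S) (hd : DifferentiableOn ℂ h S)
    {y : ℝ} (hy : ∀ u : ℝ, (u + y * I : ℂ) ∈ S) : Continuous fun u : ℝ => h (u + y * I) := by
  rw [continuous_iff_continuousAt]
  intro u
  refine ContinuousAt.comp (f := fun u : ℝ => (u + y * I : ℂ))
    (hd.differentiableAt (hS.mem_nhds (hy u))).continuousAt ?_
  fun_prop

theorem norm_mul_inv_cosh_pow_le {w : ℂ} {y C α u : ℝ} (n : ℕ) (hy : Real.cos y ≠ 0)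
    (hb : ‖w‖ ≤ C * Real.exp (α * |u|)) :
    ‖w * (cosh (u + y * I))⁻¹ ^ n‖ ≤
      C * (2 / |Real.cos y|) ^ n * Real.exp (-((n - α) * |u|)) := by
  rw [norm_mul, norm_pow]
  calc _ ≤ C * Real.exp (α * |u|) * (2 / |Real.cos y| * Real.exp (-|u|)) ^ n :=
        mul_le_mul hb (pow_le_pow_left₀ (norm_nonneg _) (norm_inv_cosh_le hy u) n) (by positivity)
          ((norm_nonneg _).trans hb)
    _ = _ := by
      rw [mul_pow, ← Real.exp_nat_mul, mul_mul_mul_comm, ← Real.exp_add]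
      congr 2; ring

theorem integrable_mul_inv_cosh_pow {h : ℝ → ℂ} {y C α : ℝ} (n : ℕ) (hy : Real.cos y ≠ 0)
    (hα : α < n) (hc : Continuous h) (hb : ∀ u : ℝ, ‖h u‖ ≤ C * Real.exp (α * |u|)) :
    Integrable fun u : ℝ => h u * (cosh (u + y * I))⁻¹ ^ n := by
  refine ((integrable_exp_neg_mul_abs (sub_pos.2 hα)).const_mul (C * (2 / |Real.cos y|) ^ n)).mono'
    ?_ (Eventually.of_forall fun u => norm_mul_inv_cosh_pow_le n hy (hb u))
  refine (hc.mul (Continuous.pow (Continuous.inv₀ ?_ (cosh_add_mul_I_ne_zero hy)) n)).aestronglyMeasurable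
  exact continuous_cosh.comp (by fun_prop)

theorem exp_le_four_mul_sinh {R : ℝ} (hR : 1 ≤ R) : Real.exp R ≤ 4 * Real.sinh R := by
  rw [Real.sinh_eq]
  have h1 : Real.exp (-R) * Real.exp R = 1 := by rw [← Real.exp_add]; simp
  have h2 : 2 ≤ Real.exp R := by linarith [Real.add_one_le_exp R]
  nlinarith [Real.exp_pos (-R)]

theorem norm_mul_inv_cosh_le_of_one_le {w : ℂ} {u y : ℝ} (hu : 1 ≤ |u|) :
    ‖w * (cosh (u + y * I))⁻¹‖ ≤ 4 * ‖w‖ * Real.exp (-|u|) := by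
  have h1 := exp_le_four_mul_sinh hu
  have h2 : Real.sinh |u| ≤ ‖cosh (u + y * I)‖ := by
    rw [← Real.abs_sinh]; exact abs_sinh_le_norm_cosh u y
  have h3 : 0 < ‖cosh (u + y * I)‖ := by linarith [Real.exp_pos |u|]
  rw [norm_mul, norm_inv, Real.exp_neg, ← div_eq_mul_inv, ← div_eq_mul_inv,
    div_le_div_iff₀ h3 (Real.exp_pos _)]
  nlinarith [norm_nonneg w]

theorem tendsto_const_mul_exp_neg_mul (C : ℝ) {β : ℝ} (hβ : 0 < β) :
    Tendsto (fun R : ℝ => C * Real.exp (-(β * R))) atTop (𝓝 0) := by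
  rw [← mul_zero C]
  exact (Real.tendsto_exp_neg_atTop_nhds_zero.comp (tendsto_id.const_mul_atTop hβ)).const_mul C

theorem integral_inv_cosh : ∫ u : ℝ, (Real.cosh u)⁻¹ = Real.pi := by
  have hd : ∀ u : ℝ, HasDerivAt (fun u => Real.arctan (Real.sinh u)) (Real.cosh u)⁻¹ u := by
    intro u
    refine ((Real.hasDerivAt_sinh u).arctan).congr_deriv ?_
    have := Real.cosh_sq u
    have h0 := (Real.cosh_pos u).ne'
    rw [add_comm, ← this]; field_simp
  have hi : Integrable fun u : ℝ => (Real.cosh u)⁻¹ := by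
    refine ((integrable_exp_neg_mul_abs one_pos).const_mul 2).mono'
      (Real.continuous_cosh.inv₀ fun u => (Real.cosh_pos u).ne').aestronglyMeasurable
      (Eventually.of_forall fun u => ?_)
    rw [one_mul, Real.norm_of_nonneg (inv_nonneg.2 (Real.cosh_pos u).le), Real.exp_neg,
      ← one_div, ← div_eq_mul_inv, div_le_div_iff₀ (Real.cosh_pos u) (Real.exp_pos _)]
    linarith [Real.exp_abs_le_two_mul_cosh u]
  have ht : Tendsto Real.sinh atTop atTop := by
    refine tendsto_atTop_mono' _ ?_ tendsto_id
    filter_upwards [eventually_ge_atTop 0] with u hu using Real.self_le_sinh_iff.2 hu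
  have hb : Tendsto Real.sinh atBot atBot := by
    have := tendsto_neg_atTop_atBot.comp (ht.comp tendsto_neg_atBot_atTop)
    refine this.congr fun u => by simp
  rw [integral_of_hasDerivAt_of_tendsto hd hi
    ((Real.tendsto_arctan_atBot.mono_right nhdsWithin_le_nhds).comp hb)
    ((Real.tendsto_arctan_atTop.mono_right nhdsWithin_le_nhds).comp ht)]
  ring

/-- This value replaces the residue theorem: it accounts for the part of `h / cosh` that is left
after the pole has been subtracted. -/
theorem coshIntegral_one_one : coshIntegral 1 1 = Real.pi := by
  have hq := Real.pi_pos
  have key := integral_line_eq_of_differentiableOn (f := fun z => (cosh z)⁻¹ ) (y₁ := 0)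
    (y₂ := Real.pi / 4) (by positivity) ?_ ?_ ?_ (tendsto_const_mul_exp_neg_mul 4 one_pos) ?_
  · rw [coshIntegral]
    simp only [Pi.one_apply, one_mul, pow_one]
    rw [← key, ← integral_inv_cosh, ← integral_complex_ofReal]
    congr 1; ext u; simp
  · refine differentiable_cosh.differentiableOn.inv fun z hz => ?_
    have := cosh_add_mul_I_ne_zero (y := z.im) (Real.cos_pos_of_mem_Ioo ⟨?_, ?_⟩).ne' z.re
    · rwa [re_add_im] at this
    · linarith [hz.1]
    · linarith [hz.2]
  · simpa using integrable_mul_inv_cosh_pow (h := fun _ => 1) (y := 0) (C := 1) (α := 0) 1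
      (by simp) (by simp) continuous_const (by simp)
  · simpa using integrable_mul_inv_cosh_pow (h := fun _ => 1) (C := 1) (α := 0) 1
      Real.cos_pi_div_four_ne_zero (by simp) continuous_const (by simp)
  · filter_upwards [eventually_ge_atTop 1] with R hR u hu y _
    simpa [hu] using norm_mul_inv_cosh_le_of_one_le (w := 1) (u := u) (y := y) (hu ▸ hR)

theorem cosh_line_add_pi (u : ℝ) : cosh (u + (5 * Real.pi / 4 : ℝ) * I) =
    -cosh (u + (Real.pi / 4 : ℝ) * I) := by
  rw [← cosh_add_pi_mul_I]; congr 1; push_cast; ring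

theorem line_add_pi (u : ℝ) : (u + (Real.pi / 4 : ℝ) * I + Real.pi * I : ℂ) =
    u + (5 * Real.pi / 4 : ℝ) * I := by
  push_cast; ring

theorem line_ne_pi_div_two_mul_I {y : ℝ} (hy : y ≠ Real.pi / 2) (u : ℝ) :
    (u + y * I : ℂ) ≠ Real.pi / 2 * I := by
  intro h
  have := congrArg im h
  rw [pi_div_two_mul_I_im] at this
  simp at this
  exact hy this

theorem Real.cos_five_pi_div_four_ne_zero : Real.cos (5 * Real.pi / 4) ≠ 0 := by
  rw [show 5 * Real.pi / 4 = Real.pi / 4 + Real.pi by ring, Real.cos_add_pi]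
  exact neg_ne_zero.2 Real.cos_pi_div_four_ne_zero

/-- The quotient `(h - h(iπ/2)) / cosh` has no pole in the strip, so its integrals at heights `π/4`
and `5π/4` agree. Since `cosh` changes sign under translation by `πi`, the constant `h(iπ/2)`
contributes `π` from each of the two lines. -/
theorem coshIntegral_one_add_shift {h : ℂ → ℂ}
    (hd : DifferentiableOn ℂ h {z | 0 < z.im ∧ z.im < 3 * Real.pi / 2}) {C α : ℝ} (hα : α < 1)
    (hb : ∀ z : ℂ, z.im ∈ Icc (Real.pi / 4) (5 * Real.pi / 4) → ‖h z‖ ≤ C * Real.exp (α * |z.re|)) :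
    coshIntegral 1 h + coshIntegral 1 (fun z => h (z + Real.pi * I)) =
      2 * Real.pi * h (Real.pi / 2 * I) := by
  have hp := Real.pi_pos
  have n₁ : Real.pi / 4 ≠ Real.pi / 2 := by linarith
  have n₂ : 5 * Real.pi / 4 ≠ Real.pi / 2 := by linarith
  have hline : ∀ y ∈ Icc (Real.pi / 4) (5 * Real.pi / 4), ∀ u : ℝ,
      ‖h (u + y * I)‖ ≤ C * Real.exp (α * |u|) := fun y hy u => by
    simpa using hb (u + y * I) (by simpa using hy)
  have hint : ∀ y ∈ Icc (Real.pi / 4) (5 * Real.pi / 4), Real.cos y ≠ 0 →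
      Integrable fun u : ℝ => h (u + y * I) * (cosh (u + y * I))⁻¹ := fun y hy hc => by
    simpa using integrable_mul_inv_cosh_pow 1 hc (by simpa using hα) (continuous_line_comp
      (isOpen_strip _ _) hd fun u => ⟨by simp; linarith [hy.1], by simp; linarith [hy.2]⟩)
      (hline y hy)
  have hone : ∀ y : ℝ, Real.cos y ≠ 0 → Integrable fun u : ℝ => (cosh (u + y * I))⁻¹ :=
    fun y hc => by
      simpa using integrable_mul_inv_cosh_pow (h := fun _ => 1) (y := y) (C := 1) (α := 0) 1
        hc (by simp) continuous_const (by simp)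
  have m₁ : Real.pi / 4 ∈ Icc (Real.pi / 4) (5 * Real.pi / 4) := ⟨le_rfl, by linarith⟩
  have m₂ : 5 * Real.pi / 4 ∈ Icc (Real.pi / 4) (5 * Real.pi / 4) := ⟨by linarith, le_rfl⟩
  have i₁ := hint _ m₁ Real.cos_pi_div_four_ne_zero
  have i₂ := hint _ m₂ Real.cos_five_pi_div_four_ne_zero
  have j₁ := (hone _ Real.cos_pi_div_four_ne_zero).const_mul (h (Real.pi / 2 * I))
  have j₂ := (hone _ Real.cos_five_pi_div_four_ne_zero).const_mul (h (Real.pi / 2 * I))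
  have e : ∀ y : ℝ, y ≠ Real.pi / 2 → (fun u : ℝ => coshQuot h (u + y * I)) = fun u : ℝ =>
      h (u + y * I) * (cosh (u + y * I))⁻¹ - h (Real.pi / 2 * I) * (cosh (u + y * I))⁻¹ := by
    intro y hy; ext u
    rw [coshQuot_of_ne h (line_ne_pi_div_two_mul_I hy u), sub_mul]
  have key := integral_line_eq_of_differentiableOn (f := coshQuot h) (y₁ := Real.pi / 4)
    (y₂ := 5 * Real.pi / 4) (by linarith) ((differentiableOn_coshQuot hd).mono fun z hz =>
      ⟨by linarith [hz.1], by linarith [hz.2]⟩) (by rw [e _ n₁]; exact i₁.sub j₁)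
    (by rw [e _ n₂]; exact i₂.sub j₂) (B := fun R => 4 * C * Real.exp (-((1 - α) * R)) +
      4 * ‖h (Real.pi / 2 * I)‖ * Real.exp (-(1 * R))) ?_ ?_
  · rw [e _ n₁, e _ n₂, integral_sub i₁ j₁, integral_sub i₂ j₂, integral_const_mul,
      integral_const_mul] at key
    have c := coshIntegral_one_one
    rw [coshIntegral] at c ⊢
    rw [coshIntegral]
    simp only [Pi.one_apply, one_mul, pow_one, line_add_pi] at c ⊢
    simp only [cosh_line_add_pi, inv_neg, mul_neg, integral_neg] at key
    rw [c] at key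
    linear_combination key
  · simpa using (tendsto_const_mul_exp_neg_mul (4 * C) (sub_pos.2 hα)).add
      (tendsto_const_mul_exp_neg_mul (4 * ‖h (Real.pi / 2 * I)‖) one_pos)
  · filter_upwards [eventually_ge_atTop 1] with R hR u hu y hy
    have hne : (u + y * I : ℂ) ≠ Real.pi / 2 * I := by
      intro h0
      have := congrArg re h0
      simp at this
      rw [this, abs_zero] at hu; linarith
    rw [coshQuot_of_ne h hne]
    refine (norm_mul_inv_cosh_le_of_one_le (hu ▸ hR)).trans ?_
    have h1 := (norm_sub_le (h (u + y * I)) (h (Real.pi / 2 * I))).trans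
      (add_le_add_left (hline y hy u) _)
    rw [hu] at h1 ⊢
    have h2 : Real.exp (-((1 - α) * R)) = Real.exp (α * R) * Real.exp (-R) := by
      rw [← Real.exp_add]; congr 1; ring
    rw [h2, one_mul]
    nlinarith [Real.exp_pos (-R)]

/-- The relation for a simple pole is applied to `coshQuot H`, whose value at `iπ/2` is `-i
H'(iπ/2)`. The terms with `H(iπ/2) / cosh²` from the two lines cancel. -/
theorem coshIntegral_two_sub_shift {H : ℂ → ℂ}
    (hd : DifferentiableOn ℂ H {z | 0 < z.im ∧ z.im < 3 * Real.pi / 2}) {C α : ℝ} (hα₀ : 0 ≤ α)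
    (hα : α < 1)
    (hb : ∀ z : ℂ, z.im ∈ Icc (Real.pi / 4) (5 * Real.pi / 4) → ‖H z‖ ≤ C * Real.exp (α * |z.re|)) :
    coshIntegral 2 H - coshIntegral 2 (fun z => H (z + Real.pi * I)) =
      -(2 * Real.pi * I) * deriv H (Real.pi / 2 * I) := by
  have hp := Real.pi_pos
  have n₁ : Real.pi / 4 ≠ Real.pi / 2 := by linarith
  have n₂ : 5 * Real.pi / 4 ≠ Real.pi / 2 := by linarith
  have hdq := differentiableOn_coshQuot hd
  -- The lower bound for `|cosh|` by `sinh` is only usable for `|Re z| ≥ 1`; near the removed pole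
  -- the bound comes from compactness.
  obtain ⟨K, hK⟩ : ∃ K, ∀ z ∈ Icc (-1) 1 ×ℂ Icc (Real.pi / 4) (5 * Real.pi / 4),
      ‖coshQuot H z‖ ≤ K := by
    refine (isCompact_Icc.reProdIm isCompact_Icc).exists_bound_of_continuousOn
      (hdq.continuousOn.mono fun z hz => ?_)
    have := hz.2
    exact ⟨by linarith [this.1], by linarith [this.2]⟩
  have hC : 0 ≤ C := by
    have := (norm_nonneg _).trans (hb ((Real.pi / 4 : ℝ) * I) (by simp; linarith))
    simpa using this
  have key := coshIntegral_one_add_shift hdq (C := max K (4 * (C + ‖H (Real.pi / 2 * I)‖))) hα ?_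
  · have e₁ : (fun u : ℝ => coshQuot H (u + (Real.pi / 4 : ℝ) * I) *
          (cosh (u + (Real.pi / 4 : ℝ) * I))⁻¹) = fun u : ℝ =>
        H (u + (Real.pi / 4 : ℝ) * I) * (cosh (u + (Real.pi / 4 : ℝ) * I))⁻¹ ^ 2 -
        H (Real.pi / 2 * I) * (cosh (u + (Real.pi / 4 : ℝ) * I))⁻¹ ^ 2 := by
      ext u
      rw [coshQuot_of_ne H (line_ne_pi_div_two_mul_I n₁ u)]; ring
    have e₂ : (fun u : ℝ => coshQuot H (u + (5 * Real.pi / 4 : ℝ) * I) *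
          (cosh (u + (Real.pi / 4 : ℝ) * I))⁻¹) = fun u : ℝ =>
        H (Real.pi / 2 * I) * (cosh (u + (Real.pi / 4 : ℝ) * I))⁻¹ ^ 2 -
        H (u + (5 * Real.pi / 4 : ℝ) * I) * (cosh (u + (Real.pi / 4 : ℝ) * I))⁻¹ ^ 2 := by
      ext u
      rw [coshQuot_of_ne H (line_ne_pi_div_two_mul_I n₂ u), cosh_line_add_pi, inv_neg]; ring
    have j := (integrable_mul_inv_cosh_pow (h := fun _ => 1) (C := 1) (α := 0) 2
      Real.cos_pi_div_four_ne_zero (by simp) continuous_const (by simp)).const_mul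
      (H (Real.pi / 2 * I))
    simp only [one_mul] at j
    have i : ∀ y ∈ Icc (Real.pi / 4) (5 * Real.pi / 4), Integrable fun u : ℝ =>
        H (u + y * I) * (cosh (u + (Real.pi / 4 : ℝ) * I))⁻¹ ^ 2 := fun y hy =>
      integrable_mul_inv_cosh_pow (α := α) 2 Real.cos_pi_div_four_ne_zero (by push_cast; linarith)
        (continuous_line_comp (isOpen_strip _ _) hd fun u =>
          ⟨by simp; linarith [hy.1], by simp; linarith [hy.2]⟩)
        fun u => by simpa using hb (u + y * I) (by simpa using hy)
    rw [coshQuot_self] at key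
    simp only [coshIntegral, pow_one, line_add_pi] at key ⊢
    rw [e₁, e₂, integral_sub (i _ ⟨le_rfl, by linarith⟩) j,
      integral_sub j (i _ ⟨by linarith, le_rfl⟩)] at key
    linear_combination key
  · intro z hz
    have h1 : 1 ≤ Real.exp (α * |z.re|) := Real.one_le_exp (by positivity)
    rcases le_or_gt |z.re| 1 with hr | hr
    · have := hK z ⟨abs_le.1 hr, hz⟩
      calc _ ≤ K := this
        _ ≤ K * Real.exp (α * |z.re|) := le_mul_of_one_le_right ((norm_nonneg _).trans this) h1
        _ ≤ _ := by gcongr; exact le_max_left _ _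
    · have hne : z ≠ Real.pi / 2 * I := by
        intro h0
        rw [h0] at hr
        simp at hr
        linarith
      rw [coshQuot_of_ne H hne]
      have h2 := norm_mul_inv_cosh_le_of_one_le (w := H z - H (Real.pi / 2 * I)) (y := z.im) hr.le
      rw [re_add_im] at h2
      have h3 := norm_sub_le (H z) (H (Real.pi / 2 * I))
      have h4 := hb z hz
      have h5 : Real.exp (-|z.re|) ≤ 1 := Real.exp_le_one_iff.2 (by linarith)
      calc _ ≤ 4 * ‖H z - H (Real.pi / 2 * I)‖ * 1 := h2.trans (by gcongr)
        _ ≤ 4 * (C + ‖H (Real.pi / 2 * I)‖) * Real.exp (α * |z.re|) := by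
          nlinarith [norm_nonneg (H (Real.pi / 2 * I))]
        _ ≤ _ := by gcongr; exact le_max_right _ _

end CoshIntegral

/-! ### Power series over the zeros of `cosh` and their continuation by an integral. -/

section Lerch

open Filter Topology Complex

/-- `h` is holomorphic on the upper half plane, and of subexponential growth on each half plane
`ε ≤ im z` with `0 < ε`. -/
structure UpperSubexp (h : ℂ → ℂ) : Prop where
  diff : DifferentiableOn ℂ h {z | 0 < z.im}
  growth : ∀ ε > 0, ∀ δ > 0, ∃ C, ∀ z : ℂ, ε ≤ z.im → ‖h z‖ ≤ C * Real.exp (δ * ‖z‖)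

theorem isOpen_upper : IsOpen {z : ℂ | 0 < z.im} := isOpen_lt continuous_const continuous_im

/-- The bound separates the decay in `Im z`, which drives the remainder to `0` under translations,
from the growth in `Re z`, which `cosh` absorbs. The factor `h` costs only `δ` in each. -/
theorem UpperSubexp.exp_mul_bound {h : ℂ → ℂ} (hh : UpperSubexp h) {ε δ : ℝ} (hε : 0 < ε)
    (hδ : 0 < δ) : ∃ C, 0 ≤ C ∧ ∀ p z : ℂ, ε ≤ z.im → ‖exp (p * z) * h z‖ ≤
      C * Real.exp ((δ - p.im) * z.im) * Real.exp ((|p.re| + δ) * |z.re|) := by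
  obtain ⟨C, hC⟩ := hh.growth ε hε δ hδ
  have hC0 : 0 ≤ C := by
    have := (norm_nonneg _).trans (hC (ε * I) (by simp))
    exact nonneg_of_mul_nonneg_left this (Real.exp_pos _)
  refine ⟨C, hC0, fun p z hz => ?_⟩
  rw [norm_mul, norm_exp, mul_assoc C, ← Real.exp_add]
  calc _ ≤ Real.exp (p * z).re * (C * Real.exp (δ * ‖z‖)) := by gcongr; exact hC z hz
    _ = C * Real.exp ((p * z).re + δ * ‖z‖) := by rw [Real.exp_add]; ring
    _ ≤ _ := by
      refine mul_le_mul_of_nonneg_left (Real.exp_le_exp.2 ?_) hC0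
      have h1 := norm_le_abs_re_add_abs_im z
      rw [abs_of_nonneg (hε.le.trans hz)] at h1
      have h2 : p.re * z.re ≤ |p.re| * |z.re| := by rw [← abs_mul]; exact le_abs_self _
      rw [mul_re]
      nlinarith [mul_le_mul_of_nonneg_left h1 hδ.le]

theorem UpperSubexp.differentiableOn_exp_mul {h : ℂ → ℂ} (hh : UpperSubexp h) (p : ℂ) :
    DifferentiableOn ℂ (fun z => exp (p * z) * h z) {z | 0 < z.im} :=
  DifferentiableOn.mul (by fun_prop) hh.diff

theorem UpperSubexp.continuous_line {h : ℂ → ℂ} (hh : UpperSubexp h) (p : ℂ) {y : ℝ} (hy : 0 < y) :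
    Continuous fun u : ℝ => exp (p * (u + y * I)) * h (u + y * I) :=
  continuous_line_comp isOpen_upper (hh.differentiableOn_exp_mul p) fun u => by simpa using hy

theorem UpperSubexp.integrable_line {h : ℂ → ℂ} (hh : UpperSubexp h) {p : ℂ} {n : ℕ}
    (hp : |p.re| < n) {y : ℝ} (hy : 0 < y) (hc : Real.cos y ≠ 0) :
    Integrable fun u : ℝ =>
      exp (p * (u + y * I)) * h (u + y * I) * (cosh (u + y * I))⁻¹ ^ n := by
  obtain ⟨C, -, hC⟩ := hh.exp_mul_bound hy (half_pos (sub_pos.2 hp))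
  refine integrable_mul_inv_cosh_pow (C := C * Real.exp (((n - |p.re|) / 2 - p.im) * y))
    (α := |p.re| + (n - |p.re|) / 2) n hc (by linarith)
    (hh.continuous_line p hy) fun u => ?_
  simpa using hC p (u + y * I) (by simp)

/-- The point is that `K` does not depend on `h`, so that a whole sequence of remainders is
controlled at once. -/
theorem norm_coshIntegral_le {n : ℕ} {α : ℝ} (hα : α < n) : ∃ K, ∀ (C : ℝ) (h : ℂ → ℂ),
    (∀ u : ℝ, ‖h (u + (Real.pi / 4 : ℝ) * I)‖ ≤ C * Real.exp (α * |u|)) →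
      ‖coshIntegral n h‖ ≤ C * K := by
  refine ⟨∫ u : ℝ, (2 / |Real.cos (Real.pi / 4)|) ^ n * Real.exp (-((n - α) * |u|)),
    fun C h hC => ?_⟩
  rw [← integral_const_mul]
  refine norm_integral_le_of_norm_le (((integrable_exp_neg_mul_abs (sub_pos.2 hα)).const_mul _).const_mul _)
    (Eventually.of_forall fun u => ?_)
  rw [← mul_assoc]
  exact norm_mul_inv_cosh_pow_le n Real.cos_pi_div_four_ne_zero (hC u)

theorem UpperSubexp.differentiableAt_coshIntegral {h : ℂ → ℂ} (hh : UpperSubexp h) {n : ℕ} {p : ℂ}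
    (hp : |p.re| < n) :
    DifferentiableAt ℂ (fun p => coshIntegral n fun z => exp (p * z) * h z) p := by
  have hq : 0 < Real.pi / 4 := by positivity
  -- A third of the gap is spent on moving `p`, a third on the growth of `h`, and a third is left as
  -- exponential decay.
  set δ : ℝ := (n - |p.re|) / 3 with hδ
  have hδ0 : 0 < δ := div_pos (sub_pos.2 hp) (by norm_num)
  obtain ⟨C, hC0, hC⟩ := hh.exp_mul_bound hq hδ0
  have hball : ∀ r ∈ Metric.ball p δ, |r.re| ≤ |p.re| + δ ∧ p.im - δ ≤ r.im := fun r hr => by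
    rw [Metric.mem_ball, dist_eq_norm] at hr
    have h1 := (abs_re_le_norm (r - p)).trans hr.le
    have h2 := (abs_im_le_norm (r - p)).trans hr.le
    rw [sub_re] at h1
    rw [sub_im] at h2
    refine ⟨?_, by linarith [(abs_le.1 h2).1]⟩
    have := abs_add_le (r.re - p.re) p.re
    rw [sub_add_cancel] at this
    linarith
  set M : ℝ := C * Real.exp ((δ - (p.im - δ)) * (Real.pi / 4)) with hM
  refine differentiableAt_integral_of_locally_dominated hδ0
    (B := fun u => M * (2 / |Real.cos (Real.pi / 4)|) ^ n *
      Real.exp (-((n - (|p.re| + 2 * δ)) * |u|))) (fun r hr => ?_) (fun u => ?_) ?_ fun u r hr => ?_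
  · refine (hh.integrable_line ?_ hq Real.cos_pi_div_four_ne_zero).aestronglyMeasurable
    have := (hball r hr).1
    linarith
  · fun_prop
  · exact (integrable_exp_neg_mul_abs (by linarith)).const_mul _
  · refine norm_mul_inv_cosh_pow_le n Real.cos_pi_div_four_ne_zero ?_
    have := hC r (u + (Real.pi / 4 : ℝ) * I) (by simp)
    refine this.trans ?_
    obtain ⟨h1, h2⟩ := hball r hr
    have e1 : (u + (Real.pi / 4 : ℝ) * I : ℂ).im = Real.pi / 4 := by simp
    have e2 : (u + (Real.pi / 4 : ℝ) * I : ℂ).re = u := by simp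
    rw [e1, e2, hM]
    refine mul_le_mul (mul_le_mul_of_nonneg_left (Real.exp_le_exp.2 ?_) hC0)
      (Real.exp_le_exp.2 (mul_le_mul_of_nonneg_right (by linarith) (abs_nonneg u)))
      (Real.exp_pos _).le (by positivity)
    exact mul_le_mul_of_nonneg_right (by linarith) hq.le

/-- The zeros of `cosh` in the upper half plane. -/
noncomputable def coshZero (n : ℕ) : ℂ := (n + 1 / 2) * (Real.pi * I)

theorem coshZero_im (n : ℕ) : (coshZero n).im = (n + 1 / 2) * Real.pi := by
  simp [coshZero]

/-- Since `‖h‖` at the `n`-th zero is at most a constant times `e^(δπn)`, a choice of `δ` with `r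
e^(δπ) < 1` gives a geometric majorant. -/
theorem UpperSubexp.summable_norm {h : ℂ → ℂ} (hh : UpperSubexp h) {r : ℝ} (hr0 : 0 ≤ r)
    (hr : r < 1) : Summable fun n : ℕ => r ^ n * ‖h (coshZero n)‖ := by
  have hp := Real.pi_pos
  obtain ⟨δ, hδ, hδ0⟩ : ∃ δ : ℝ, r * Real.exp (δ * Real.pi) < 1 ∧ 0 < δ := by
    have hc : Tendsto (fun δ : ℝ => r * Real.exp (δ * Real.pi)) (𝓝[>] 0) (𝓝 r) := by
      have : Continuous fun δ : ℝ => r * Real.exp (δ * Real.pi) := by fun_prop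
      have := this.tendsto 0
      simp only [zero_mul, Real.exp_zero, mul_one] at this
      exact this.mono_left nhdsWithin_le_nhds
    exact ((hc.eventually (gt_mem_nhds hr)).and self_mem_nhdsWithin).exists
  obtain ⟨C, hC⟩ := hh.growth (Real.pi / 2) (by positivity) δ hδ0
  refine Summable.of_nonneg_of_le (fun n => by positivity) (fun n => ?_)
    ((summable_geometric_of_lt_one (by positivity) hδ).mul_left (C * Real.exp (δ * (Real.pi / 2))))
  have hn : ‖coshZero n‖ = n * Real.pi + Real.pi / 2 := by
    rw [coshZero, norm_mul, norm_mul, norm_I, mul_one, norm_real, Real.norm_of_nonneg hp.le]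
    have : ((n : ℂ) + 1 / 2) = ((n + 1 / 2 : ℝ) : ℂ) := by push_cast; ring
    rw [this, norm_real, Real.norm_of_nonneg (by positivity)]
    ring
  have h1 := hC (coshZero n) (by
    rw [coshZero_im]; nlinarith [(Nat.cast_nonneg n : (0 : ℝ) ≤ n)])
  rw [hn] at h1
  calc _ ≤ r ^ n * (C * Real.exp (δ * (n * Real.pi + Real.pi / 2))) := by gcongr
    _ = _ := by
      rw [mul_pow, ← Real.exp_nat_mul, mul_add, Real.exp_add]
      ring_nf

theorem UpperSubexp.coshIntegral_one_eq_sum {h : ℂ → ℂ} (hh : UpperSubexp h) {p : ℂ}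
    (hp : |p.re| < 1) (N : ℕ) :
    coshIntegral 1 (fun z => exp (p * z) * h z) =
      2 * Real.pi * ∑ n ∈ Finset.range N, (-1) ^ n * (exp (p * coshZero n) * h (coshZero n)) +
      (-1) ^ N * coshIntegral 1 (fun z => exp (p * (z + N * (Real.pi * I))) *
        h (z + N * (Real.pi * I))) := by
  induction N with
  | zero => simp
  | succ N ih =>
    have hπ := Real.pi_pos
    obtain ⟨C, hC0, hC⟩ := hh.exp_mul_bound (ε := Real.pi / 4) (by positivity)
      (half_pos (sub_pos.2 hp))
    have him : ∀ z : ℂ, (z + N * (Real.pi * I)).im = z.im + N * Real.pi := fun z => by simp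
    have hre : ∀ z : ℂ, (z + N * (Real.pi * I)).re = z.re := fun z => by simp
    have key := coshIntegral_one_add_shift (h := fun z => exp (p * (z + N * (Real.pi * I))) *
        h (z + N * (Real.pi * I))) (C := C * Real.exp (|(1 - |p.re|) / 2 - p.im| *
          (5 * Real.pi / 4 + N * Real.pi)))
        (α := |p.re| + (1 - |p.re|) / 2) ?_ (by linarith) ?_
    · have e1 : (Real.pi / 2 * I + N * (Real.pi * I) : ℂ) = coshZero N := by rw [coshZero]; ring
      have e2 : ∀ z : ℂ, z + Real.pi * I + N * (Real.pi * I) =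
          z + (N + 1 : ℕ) * (Real.pi * I) := fun z => by push_cast; ring
      simp only [e1, e2] at key
      rw [ih, Finset.sum_range_succ, pow_succ]
      linear_combination (-1) ^ N * key
    · refine DifferentiableOn.comp (t := {z | 0 < z.im}) (hh.differentiableOn_exp_mul p)
        (f := fun z => z + N * (Real.pi * I)) (by fun_prop) fun z hz => ?_
      rw [mem_ofPred_eq, him]
      have := hz.1
      positivity
    · intro z hz
      refine (hC p _ ?_).trans ?_
      · rw [him]; have := hz.1; linarith [mul_nonneg (Nat.cast_nonneg N) hπ.le]
      · rw [him, hre]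
        have h1 : 0 ≤ (N : ℝ) * Real.pi := by positivity
        have h0 : 0 ≤ z.im := by linarith [hz.1]
        gcongr
        · exact le_abs_self _
        · exact hz.2

/-- After `N` translations the remainder is of order `e^((δ - Im p)πN)`, which tends to `0` once `δ
< Im p`. -/
theorem UpperSubexp.hasSum_coshIntegral_one {h : ℂ → ℂ} (hh : UpperSubexp h) {p : ℂ}
    (hp : |p.re| < 1) (hp0 : 0 < p.im) :
    HasSum (fun n : ℕ => (-exp (p * (Real.pi * I))) ^ n * h (coshZero n))
      (coshIntegral 1 (fun z => exp (p * z) * h z) /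
        (2 * Real.pi * exp (p * (Real.pi / 2 * I)))) := by
  have hπ := Real.pi_pos
  have hz : ‖-exp (p * (Real.pi * I))‖ < 1 := by
    rw [norm_neg, norm_exp, Real.exp_lt_one_iff]
    simp
    positivity
  have hs := hh.summable_norm (norm_nonneg _) hz
  have hs' : Summable fun n : ℕ => (-exp (p * (Real.pi * I))) ^ n * h (coshZero n) :=
    Summable.of_norm (by simpa only [norm_mul, norm_pow] using hs)
  rw [hs'.hasSum_iff_tendsto_nat]
  have hne : (2 * Real.pi * exp (p * (Real.pi / 2 * I)) : ℂ) ≠ 0 :=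
    mul_ne_zero (mul_ne_zero two_ne_zero (ofReal_ne_zero.2 hπ.ne')) (exp_ne_zero _)
  obtain ⟨δ, hδ0, hδ1, hδ2⟩ : ∃ δ, 0 < δ ∧ |p.re| + δ < 1 ∧ δ < p.im := by
    refine ⟨min ((1 - |p.re|) / 2) (p.im / 2), lt_min (by linarith) (by linarith), ?_, ?_⟩
    · linarith [min_le_left ((1 - |p.re|) / 2) (p.im / 2)]
    · linarith [min_le_right ((1 - |p.re|) / 2) (p.im / 2)]
  obtain ⟨C, hC0, hC⟩ := hh.exp_mul_bound (ε := Real.pi / 4) (by positivity) hδ0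
  obtain ⟨K, hK⟩ := norm_coshIntegral_le (n := 1) (α := |p.re| + δ) (by simpa using hδ1)
  have hR : Tendsto (fun N : ℕ => (-1) ^ N * coshIntegral 1 (fun z =>
      exp (p * (z + N * (Real.pi * I))) * h (z + N * (Real.pi * I)))) atTop (𝓝 0) := by
    refine squeeze_zero_norm (a := fun N : ℕ => C * Real.exp ((δ - p.im) * (Real.pi / 4)) *
      Real.exp ((δ - p.im) * Real.pi) ^ N * K) (fun N => ?_) ?_
    · rw [norm_mul, norm_pow, norm_neg, norm_one, one_pow, one_mul]
      refine hK _ _ fun u => ?_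
      have him : (u + (Real.pi / 4 : ℝ) * I + N * (Real.pi * I) : ℂ).im =
          Real.pi / 4 + N * Real.pi := by simp
      have hre : (u + (Real.pi / 4 : ℝ) * I + N * (Real.pi * I) : ℂ).re = u := by simp
      have := hC p (u + (Real.pi / 4 : ℝ) * I + N * (Real.pi * I)) (by
        rw [him]; linarith [mul_nonneg (Nat.cast_nonneg N) hπ.le])
      rw [him, hre] at this
      refine this.trans_eq ?_
      rw [← Real.exp_nat_mul, mul_assoc C (Real.exp _) (Real.exp (N * _)), ← Real.exp_add]
      ring_nf
    · have : Real.exp ((δ - p.im) * Real.pi) < 1 := by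
        rw [Real.exp_lt_one_iff]; nlinarith
      simpa using ((tendsto_pow_atTop_nhds_zero_of_lt_one (Real.exp_pos _).le this).const_mul
        (C * Real.exp ((δ - p.im) * (Real.pi / 4)))).mul_const K
  have hlim := ((tendsto_const_nhds (x := coshIntegral 1 (fun z => exp (p * z) * h z))).sub
    hR).div_const (2 * Real.pi * exp (p * (Real.pi / 2 * I)))
  rw [sub_zero] at hlim
  refine hlim.congr fun N => ?_
  rw [hh.coshIntegral_one_eq_sum hp N, add_sub_cancel_right, div_eq_iff hne, Finset.mul_sum,
    Finset.sum_mul]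
  refine Finset.sum_congr rfl fun n _ => ?_
  have e : exp (p * coshZero n) = exp (p * (Real.pi * I)) ^ n * exp (p * (Real.pi / 2 * I)) := by
    rw [← exp_nat_mul, ← exp_add, coshZero]; congr 1; ring
  rw [e, neg_pow (exp (p * (Real.pi * I)))]
  ring

theorem isOpen_one_sub_slitPlane : IsOpen {z : ℂ | 1 - z ∈ slitPlane} :=
  isOpen_slitPlane.preimage (by fun_prop)

theorem neg_mem_slitPlane_of_one_le_norm {z : ℂ} (hz : 1 - z ∈ slitPlane) (h : 1 ≤ ‖z‖) :
    -z ∈ slitPlane := by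
  rw [mem_slitPlane_iff] at *
  by_cases h0 : z.im = 0
  · left
    rcases hz with hz | hz
    · have h1 : ‖z‖ = |z.re| := by
        conv_lhs => rw [← re_add_im z, h0]
        simp
      rw [h1] at h
      rw [sub_re, one_re] at hz
      rw [neg_re]
      rcases abs_cases z.re with h2 | h2 <;> linarith
    · simp [h0] at hz
  · right; simpa using h0

theorem log_exp_mul_pi_I_div {p : ℂ} (hp : |p.re| < 1) :
    log (exp (p * (Real.pi * I))) / (Real.pi * I) = p := by
  have hπ := Real.pi_pos
  have him : (p * (Real.pi * I)).im = p.re * Real.pi := by simp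
  rw [abs_lt] at hp
  rw [log_exp (by rw [him]; nlinarith) (by rw [him]; nlinarith),
    mul_div_cancel_right₀ _ (mul_ne_zero (ofReal_ne_zero.2 hπ.ne') I_ne_zero)]

/-- The map `z ↦ log(-z) / (πi)` inverts `p ↦ -e^(iπp)`; it sends `ℂ ∖ [0, ∞)` into `|Re p| < 1` and
the part with `|z| < 1` into `Im p > 0`. The series serves on the unit disc and the integral off
`[0, ∞)`; together these cover `ℂ ∖ [1, ∞)`, and the two agree where they overlap. -/
theorem UpperSubexp.exists_lerch_continuation {h : ℂ → ℂ} (hh : UpperSubexp h) :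
    ∃ f : ℂ → ℂ, DifferentiableOn ℂ f {z | 1 - z ∈ slitPlane} ∧
      (∀ z : ℂ, ‖z‖ < 1 → HasSum (fun n : ℕ => z ^ n * h (coshZero n)) (f z)) ∧
      ∀ p : ℂ, |p.re| < 1 → coshIntegral 1 (fun z => exp (p * z) * h z) =
        2 * Real.pi * exp (p * (Real.pi / 2 * I)) * f (-exp (p * (Real.pi * I))) := by
  have hπ := Real.pi_pos
  have hπI : (Real.pi * I : ℂ) ≠ 0 := mul_ne_zero (ofReal_ne_zero.2 hπ.ne') I_ne_zero
  set P : ℂ → ℂ := fun z => log (-z) / (Real.pi * I) with hP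
  set D : ℂ → ℂ := fun p => coshIntegral 1 (fun z => exp (p * z) * h z) /
    (2 * Real.pi * exp (p * (Real.pi / 2 * I))) with hD
  set S : ℂ → ℂ := fun z => ∑' n : ℕ, z ^ n * h (coshZero n) with hS
  have hne : ∀ p : ℂ, (2 * Real.pi * exp (p * (Real.pi / 2 * I)) : ℂ) ≠ 0 := fun p =>
    mul_ne_zero (mul_ne_zero two_ne_zero (ofReal_ne_zero.2 hπ.ne')) (exp_ne_zero _)
  have hsum : ∀ z : ℂ, ‖z‖ < 1 → HasSum (fun n : ℕ => z ^ n * h (coshZero n)) (S z) :=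
    fun z hz => (Summable.of_norm (by
      simpa only [norm_mul, norm_pow] using hh.summable_norm (norm_nonneg _) hz)).hasSum
  have hPre : ∀ z : ℂ, -z ∈ slitPlane → |(P z).re| < 1 := fun z hz => by
    have e : (P z).re = arg (-z) / Real.pi := by
      rw [hP]; simp only
      rw [← div_div, div_I, ← log_im, neg_re, mul_I_re, neg_neg, div_ofReal_im]
    rw [e, abs_div, abs_of_pos hπ, div_lt_one hπ]
    exact (abs_arg_le_pi _).lt_of_ne fun h0 => by
      rcases abs_cases (arg (-z)) with h1 | h1
      · exact slitPlane_arg_ne_pi hz (by linarith)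
      · linarith [neg_pi_lt_arg (-z)]
  have hPim : ∀ z : ℂ, -z ∈ slitPlane → ‖z‖ < 1 → 0 < (P z).im := fun z hz h1 => by
    have e : (P z).im = -(Real.log ‖z‖ / Real.pi) := by
      rw [hP]; simp only
      rw [← div_div, div_I, neg_im, mul_I_im, div_ofReal_re, log_re, norm_neg]
    rw [e, neg_pos]
    refine div_neg_of_neg_of_pos (Real.log_neg ?_ h1) hπ
    rw [norm_pos_iff]; rintro rfl
    simp at hz
  have hPexp : ∀ z : ℂ, -z ∈ slitPlane → -exp (P z * (Real.pi * I)) = z := fun z hz => by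
    rw [hP]; simp only
    rw [div_mul_cancel₀ _ hπI, exp_log (slitPlane_ne_zero hz), neg_neg]
  have hDS : ∀ z : ℂ, -z ∈ slitPlane → ‖z‖ < 1 → D (P z) = S z := fun z hz h1 => by
    have := hh.hasSum_coshIntegral_one (hPre z hz) (hPim z hz h1)
    rw [hPexp z hz] at this
    exact this.unique (hsum z h1)
  classical
  set f : ℂ → ℂ := fun z => if ‖z‖ < 1 then S z else D (P z) with hf
  have hfS : ∀ z : ℂ, ‖z‖ < 1 → f z = S z := fun z hz => by rw [hf]; exact if_pos hz
  have hfD : ∀ z : ℂ, -z ∈ slitPlane → f z = D (P z) := fun z hz => by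
    by_cases h1 : ‖z‖ < 1
    · rw [hfS z h1, hDS z hz h1]
    · rw [hf]; exact if_neg h1
  refine ⟨f, fun z hz => DifferentiableAt.differentiableWithinAt ?_, fun z hz => ?_, fun p hp => ?_⟩
  · by_cases h1 : ‖z‖ < 1
    · obtain ⟨r, hr1, hr2⟩ := exists_between h1
      have hd : DifferentiableOn ℂ S (Metric.ball 0 r) := by
        refine differentiableOn_tsum_of_summable_norm
          (hh.summable_norm ((norm_nonneg z).trans hr1.le) hr2) (fun n => by fun_prop)
          Metric.isOpen_ball fun n w hw => ?_
        rw [mem_ball_zero_iff] at hw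
        rw [norm_mul, norm_pow]
        gcongr
      have hz' : Metric.ball (0 : ℂ) r ∈ 𝓝 z :=
        Metric.isOpen_ball.mem_nhds (mem_ball_zero_iff.2 hr1)
      refine (hd.differentiableAt hz').congr_of_eventuallyEq ?_
      filter_upwards [hz'] with w hw using hfS w ((mem_ball_zero_iff.1 hw).trans hr2)
    · have hz' := neg_mem_slitPlane_of_one_le_norm hz (not_lt.1 h1)
      have hd : DifferentiableAt ℂ (fun w => D (P w)) z := by
        have hDd : DifferentiableAt ℂ D (P z) :=
          (hh.differentiableAt_coshIntegral (n := 1) (by simpa using hPre z hz')).div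
            (by fun_prop) (hne _)
        have hPd : DifferentiableAt ℂ P z :=
          ((differentiableAt_id.neg).clog hz').div_const _
        exact hDd.comp z hPd
      refine hd.congr_of_eventuallyEq ?_
      filter_upwards [(isOpen_slitPlane.preimage continuous_neg).mem_nhds hz'] with w hw
        using hfD w hw
  · rw [hfS z hz]; exact hsum z hz
  · have hs : exp (p * (Real.pi * I)) ∈ slitPlane := by
      rw [mem_slitPlane_iff_arg]
      have him : (p * (Real.pi * I)).im = p.re * Real.pi := by simp
      rw [abs_lt] at hp
      refine ⟨?_, exp_ne_zero _⟩
      rw [← log_im, log_exp (by rw [him]; nlinarith) (by rw [him]; nlinarith), him]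
      nlinarith
    rw [hfD _ (by rwa [neg_neg]), show P (-exp (p * (Real.pi * I))) = p by
      rw [hP]; simp only [neg_neg]; exact log_exp_mul_pi_I_div hp, hD]
    exact (mul_div_cancel₀ _ (hne p)).symm

end Lerch

/-! ### Reduction of `1 / cosh³` by parts, and the identity theorem in `p`. -/

section ByParts

open Filter Topology Complex

theorem MeasureTheory.Integrable.sub_fun {f g : ℝ → ℂ} (hf : Integrable f) (hg : Integrable g) :
    Integrable fun x => f x - g x := hf.sub hg

theorem hasDerivAt_inv_cosh_sq {z : ℂ} (hc : cosh z ≠ 0) :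
    HasDerivAt (fun z => (cosh z)⁻¹ ^ 2) (-2 * sinh z / cosh z ^ 3) z := by
  refine (((hasDerivAt_cosh z).inv hc).fun_pow 2).congr_deriv ?_
  simp only [Pi.inv_apply, Nat.add_one_sub_one, pow_one]
  field_simp
  push_cast
  ring

theorem hasDerivAt_line {φ : ℂ → ℂ} {φ' : ℂ} {u y : ℝ} (h : HasDerivAt φ φ' (u + y * I)) :
    HasDerivAt (fun u : ℝ => φ (u + y * I)) φ' u :=
  (h.comp_add_const (u : ℂ) (y * I)).comp_ofReal

theorem UpperSubexp.integrable_base {h : ℂ → ℂ} (hh : UpperSubexp h) {p : ℂ} {n : ℕ}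
    (hp : |p.re| < n) : Integrable fun u : ℝ =>
      exp (p * (u + (Real.pi / 4 : ℝ) * I)) * h (u + (Real.pi / 4 : ℝ) * I) *
        (cosh (u + (Real.pi / 4 : ℝ) * I))⁻¹ ^ n :=
  hh.integrable_line hp (by positivity) Real.cos_pi_div_four_ne_zero

/-- Let `c = 1 / cosh` and `g = e^(pz) h`. As `c'' = c - 2c³`, the derivative of `g c' - g' c` is
`(g - g'') c - 2 g c³`, and its integral vanishes. -/
theorem two_mul_coshIntegral_three {h h₁ h₂ : ℂ → ℂ} (hh : UpperSubexp h) (hh₁ : UpperSubexp h₁)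
    (hh₂ : UpperSubexp h₂) (hd : ∀ z : ℂ, 0 < z.im → HasDerivAt h (h₁ z) z)
    (hd₁ : ∀ z : ℂ, 0 < z.im → HasDerivAt h₁ (h₂ z) z) {p : ℂ} (hp : |p.re| < 1) :
    2 * coshIntegral 3 (fun z => exp (p * z) * h z) =
      (1 - p ^ 2) * coshIntegral 1 (fun z => exp (p * z) * h z) -
      2 * p * coshIntegral 1 (fun z => exp (p * z) * h₁ z) -
      coshIntegral 1 (fun z => exp (p * z) * h₂ z) := by
  have hp1 : |p.re| < (1 : ℕ) := by simpa using hp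
  have hp3 : |p.re| < (3 : ℕ) := hp.trans (by norm_num)
  have hpp : |(p + 1).re| < (2 : ℕ) := by
    rw [abs_lt] at *; simp only [add_re, one_re]; push_cast; constructor <;> linarith
  have hpm : |(p - 1).re| < (2 : ℕ) := by
    rw [abs_lt] at *; simp only [sub_re, one_re]; push_cast; constructor <;> linarith
  have i₀ := (hh.integrable_base hp1).const_mul (1 - p ^ 2)
  have i₁ := (hh₁.integrable_base hp1).const_mul (2 * p)
  have i₂ := hh₂.integrable_base hp1
  have i₃ := (hh.integrable_base hp3).const_mul 2
  have key := integral_eq_zero_of_hasDerivAt_of_integrable (fun u : ℝ => hasDerivAt_line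
    (y := Real.pi / 4) (φ := fun z => exp (p * z) * h z * (-sinh z * (cosh z)⁻¹ ^ 2) -
      exp (p * z) * (p * h z + h₁ z) * (cosh z)⁻¹)
    (φ' := (1 - p ^ 2) * (exp (p * (u + (Real.pi / 4 : ℝ) * I)) *
        h (u + (Real.pi / 4 : ℝ) * I) * (cosh (u + (Real.pi / 4 : ℝ) * I))⁻¹ ^ 1) -
      2 * p * (exp (p * (u + (Real.pi / 4 : ℝ) * I)) *
        h₁ (u + (Real.pi / 4 : ℝ) * I) * (cosh (u + (Real.pi / 4 : ℝ) * I))⁻¹ ^ 1) -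
      exp (p * (u + (Real.pi / 4 : ℝ) * I)) *
        h₂ (u + (Real.pi / 4 : ℝ) * I) * (cosh (u + (Real.pi / 4 : ℝ) * I))⁻¹ ^ 1 -
      2 * (exp (p * (u + (Real.pi / 4 : ℝ) * I)) *
        h (u + (Real.pi / 4 : ℝ) * I) * (cosh (u + (Real.pi / 4 : ℝ) * I))⁻¹ ^ 3)) ?_)
    (((i₀.sub_fun i₁).sub_fun i₂).sub i₃) ?_
  · rw [integral_sub ((i₀.sub_fun i₁).sub_fun i₂) i₃, integral_sub (i₀.sub_fun i₁) i₂, integral_sub i₀ i₁,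
      integral_const_mul, integral_const_mul, integral_const_mul] at key
    rw [coshIntegral, coshIntegral, coshIntegral, coshIntegral]
    linear_combination -key
  · have hz : 0 < (u + (Real.pi / 4 : ℝ) * I : ℂ).im := by simp; positivity
    have hc := cosh_add_mul_I_ne_zero Real.cos_pi_div_four_ne_zero u
    set z : ℂ := u + (Real.pi / 4 : ℝ) * I
    have dE : HasDerivAt (fun z => exp (p * z)) (exp (p * z) * p) z := by
      simpa using ((hasDerivAt_id z).const_mul p).cexp
    have dc : HasDerivAt (fun z => (cosh z)⁻¹) (-sinh z / cosh z ^ 2) z :=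
      (hasDerivAt_cosh z).inv hc
    refine (((dE.mul (hd z hz)).mul ((hasDerivAt_sinh z).neg.mul (hasDerivAt_inv_cosh_sq hc))).sub
      ((dE.mul (((hd z hz).const_mul p).add (hd₁ z hz))).mul dc)).congr_deriv ?_
    have hs : sinh z ^ 2 = cosh z ^ 2 - 1 := by rw [cosh_sq]; ring
    simp only [Pi.mul_apply, Pi.neg_apply, Pi.add_apply]
    field_simp
    ring_nf
    rw [hs]
    ring
  -- Writing `sinh` by exponentials shifts `p` to `p ± 1`, still within reach of `1 / cosh²`.
  · have a := ((hh.integrable_base hpm).const_mul (1 / 2)).sub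
      ((hh.integrable_base hpp).const_mul (1 / 2))
    refine ((a.sub ((hh.integrable_base hp1).const_mul p)).sub (hh₁.integrable_base hp1)).congr
      (Eventually.of_forall fun u => ?_)
    simp only [Pi.sub_apply]
    rw [sinh, add_mul, sub_mul, one_mul, exp_add, exp_sub, exp_neg]
    field_simp
    ring

/-- For `p = ±1`, `e^(pz) = cosh z + p sinh z`. The first term lowers the power of `cosh`, the
second is integrated by parts through the derivative of `h / cosh²`. -/
theorem coshIntegral_three_of_sq_eq_one {h h₁ : ℂ → ℂ} (hh : UpperSubexp h)
    (hh₁ : UpperSubexp h₁) (hd : ∀ z : ℂ, 0 < z.im → HasDerivAt h (h₁ z) z) {p : ℂ}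
    (hp : p = 1 ∨ p = -1) : coshIntegral 3 (fun z => exp (p * z) * h z) =
      coshIntegral 2 h + p / 2 * coshIntegral 2 h₁ := by
  have hp2 : p * p = 1 := by rcases hp with rfl | rfl <;> norm_num
  have hp3 : |p.re| < (3 : ℕ) := by rcases hp with rfl | rfl <;> norm_num
  have h0 : |(0 : ℂ).re| < (2 : ℕ) := by norm_num
  have hes : ∀ z : ℂ, exp (p * z) = cosh z + p * sinh z := by
    intro z
    rcases hp with rfl | rfl
    · rw [one_mul, one_mul, cosh_add_sinh]
    · rw [neg_one_mul, neg_one_mul, ← sub_eq_add_neg, cosh_sub_sinh]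
  have i₁ := hh₁.integrable_base h0
  have i₂ := hh.integrable_base h0
  have i₃ := (hh.integrable_base hp3).const_mul (2 * p)
  simp only [zero_mul, exp_zero, one_mul] at i₁ i₂
  have i₂' := i₂.const_mul (2 * p)
  have key := integral_eq_zero_of_hasDerivAt_of_integrable (fun u : ℝ => hasDerivAt_line
    (y := Real.pi / 4) (φ := fun z => h z * (cosh z)⁻¹ ^ 2)
    (φ' := h₁ (u + (Real.pi / 4 : ℝ) * I) * (cosh (u + (Real.pi / 4 : ℝ) * I))⁻¹ ^ 2 -
      2 * p * (exp (p * (u + (Real.pi / 4 : ℝ) * I)) *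
        h (u + (Real.pi / 4 : ℝ) * I) * (cosh (u + (Real.pi / 4 : ℝ) * I))⁻¹ ^ 3) +
      2 * p * (h (u + (Real.pi / 4 : ℝ) * I) * (cosh (u + (Real.pi / 4 : ℝ) * I))⁻¹ ^ 2)) ?_)
    ((i₁.sub_fun i₃).add i₂') i₂
  · rw [integral_add (i₁.sub_fun i₃) i₂', integral_sub i₁ i₃, integral_const_mul,
      integral_const_mul] at key
    rw [coshIntegral, coshIntegral, coshIntegral]
    linear_combination (-p / 2) * key + (-(∫ u : ℝ, exp (p * (u + (Real.pi / 4 : ℝ) * I)) *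
        h (u + (Real.pi / 4 : ℝ) * I) * (cosh (u + (Real.pi / 4 : ℝ) * I))⁻¹ ^ 3) +
        ∫ u : ℝ, h (u + (Real.pi / 4 : ℝ) * I) * (cosh (u + (Real.pi / 4 : ℝ) * I))⁻¹ ^ 2) * hp2
  · have hz : 0 < (u + (Real.pi / 4 : ℝ) * I : ℂ).im := by simp; positivity
    have hc := cosh_add_mul_I_ne_zero Real.cos_pi_div_four_ne_zero u
    set z : ℂ := u + (Real.pi / 4 : ℝ) * I
    refine ((hd z hz).mul (hasDerivAt_inv_cosh_sq hc)).congr_deriv ?_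
    rw [hes]
    field_simp
    linear_combination (2 * h z * sinh z) * hp2

/-- The strip `|re p| < 3` without the two half lines on which `-exp (iπp)` lies in `[1, ∞)`. -/
def cutStrip : Set ℂ := {p | |p.re| < 3 ∧ (0 < p.im ∨ |p.re| ≠ 1)}

theorem isOpen_cutStrip : IsOpen cutStrip :=
  (isOpen_lt (continuous_abs.comp continuous_re) continuous_const).inter
    ((isOpen_lt continuous_const continuous_im).union
      (isOpen_ne_fun (continuous_abs.comp continuous_re) continuous_const))

theorem isPreconnected_cutStrip : IsPreconnected cutStrip := by
  have e : cutStrip = ((re ⁻¹' Ioo (-3) 3 ∩ im ⁻¹' Ioi 0 ∪ re ⁻¹' Ioo (-1) 1) ∪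
      re ⁻¹' Ioo 1 3) ∪ re ⁻¹' Ioo (-3) (-1) := by
    ext p
    simp only [cutStrip, mem_ofPred_eq, mem_union, mem_inter_iff, mem_preimage, mem_Ioo, mem_Ioi,
      abs_lt, ne_eq]
    constructor
    · rintro ⟨⟨h1, h2⟩, h3⟩
      rcases h3 with h3 | h3
      · exact Or.inl (Or.inl (Or.inl ⟨⟨h1, h2⟩, h3⟩))
      · rcases lt_trichotomy p.re 1 with h | h | h
        · rcases lt_trichotomy p.re (-1) with h' | h' | h'
          · exact Or.inr ⟨h1, h'⟩
          · simp [h'] at h3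
          · exact Or.inl (Or.inl (Or.inr ⟨h', h⟩))
        · simp [h] at h3
        · exact Or.inl (Or.inr ⟨h, h2⟩)
    · have ab : ∀ x : ℝ, |x| = 1 → x = 1 ∨ x = -1 := fun x hx => eq_or_eq_neg_of_abs_eq hx
      rintro (((⟨⟨h1, h2⟩, h3⟩ | ⟨h1, h2⟩) | ⟨h1, h2⟩) | ⟨h1, h2⟩)
      · exact ⟨⟨h1, h2⟩, Or.inl h3⟩
      all_goals
        refine ⟨⟨by linarith, by linarith⟩, Or.inr fun h => ?_⟩
        rcases ab _ h with h | h <;> linarith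
  have c : ∀ a b : ℝ, Convex ℝ (re ⁻¹' Ioo a b) := fun a b =>
    (convex_Ioo a b).linear_preimage reLm
  have cA : Convex ℝ (re ⁻¹' Ioo (-3) 3 ∩ im ⁻¹' Ioi 0) :=
    (c _ _).inter ((convex_Ioi 0).linear_preimage imLm)
  rw [e]
  -- The upper half strip meets the three vertical strips in `I`, `2 + I` and `-2 + I`.
  refine (((cA.isPreconnected.union I ?_ ?_ (c _ _).isPreconnected).union (2 + I) ?_ ?_
    (c _ _).isPreconnected).union (-2 + I) ?_ ?_ (c _ _).isPreconnected) <;> norm_num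

/-- If `-e^(iπp)` is real and at least `1`, then `Re p` is an odd integer, here `±1`, and `Im p ≤
0`; `cutStrip` omits exactly these points. -/
theorem one_add_exp_mem_slitPlane {p : ℂ} (hp : p ∈ cutStrip) :
    1 - -exp (p * (Real.pi * I)) ∈ slitPlane := by
  have hπ := Real.pi_pos
  rw [sub_neg_eq_add, mem_slitPlane_iff]
  by_contra! hcon
  obtain ⟨h1, h2⟩ := hcon
  have hre : (p * (Real.pi * I)).re = -(p.im * Real.pi) := by simp
  have him : (p * (Real.pi * I)).im = p.re * Real.pi := by simp
  rw [add_re, one_re, exp_re, hre, him] at h1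
  rw [add_im, one_im, exp_im, hre, him, zero_add] at h2
  have h3 : Real.sin (p.re * Real.pi) = 0 := by
    rcases mul_eq_zero.1 h2 with h | h
    · exact absurd h (Real.exp_pos _).ne'
    · exact h
  obtain ⟨n, hn⟩ := Real.sin_eq_zero_iff.1 h3
  have hn' : p.re = n := (mul_right_cancel₀ hπ.ne' hn).symm
  have hn3 : |(n : ℝ)| < 3 := hn' ▸ hp.1
  rw [← Int.cast_abs] at hn3
  have hn3' : |n| < 3 := by exact_mod_cast hn3
  rw [abs_lt] at hn3'
  obtain ⟨a, b⟩ := hn3'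
  rw [hn'] at h1
  have hexp := Real.exp_pos (-(p.im * Real.pi))
  have hone : |n| = 1 → False := by
    intro hn1
    have hc : Real.cos (n * Real.pi) = -1 := by
      rcases eq_or_eq_neg_of_abs_eq hn1 with rfl | rfl <;> simp
    rw [hc] at h1
    have h4 : 1 ≤ Real.exp (-(p.im * Real.pi)) := by linarith
    rw [Real.one_le_exp_iff] at h4
    rcases hp.2 with h5 | h5
    · nlinarith
    · apply h5
      rw [hn', ← Int.cast_abs, hn1]; simp
  have htwo : Real.cos (n * Real.pi) = 1 → False := by
    intro hc
    rw [hc] at h1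
    linarith
  interval_cases n
  · apply htwo
    rw [← Real.cos_neg]
    have : -(((-2 : ℤ) : ℝ) * Real.pi) = 2 * Real.pi := by push_cast; ring
    rw [this, Real.cos_two_pi]
  · exact hone rfl
  · exact htwo (by simp)
  · exact hone rfl
  · exact htwo (by push_cast; exact Real.cos_two_pi)

/-- Both sides are holomorphic on the connected set `cutStrip`, and for `|Re p| < 1` they agree by
integration by parts. -/
theorem coshIntegral_three_eq {h h₁ h₂ : ℂ → ℂ} (hh : UpperSubexp h) (hh₁ : UpperSubexp h₁)
    (hh₂ : UpperSubexp h₂) (hd : ∀ z : ℂ, 0 < z.im → HasDerivAt h (h₁ z) z)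
    (hd₁ : ∀ z : ℂ, 0 < z.im → HasDerivAt h₁ (h₂ z) z) {f f₁ f₂ : ℂ → ℂ}
    (hf : DifferentiableOn ℂ f {z | 1 - z ∈ slitPlane})
    (hf₁ : DifferentiableOn ℂ f₁ {z | 1 - z ∈ slitPlane})
    (hf₂ : DifferentiableOn ℂ f₂ {z | 1 - z ∈ slitPlane})
    (e : ∀ p : ℂ, |p.re| < 1 → coshIntegral 1 (fun z => exp (p * z) * h z) =
        2 * Real.pi * exp (p * (Real.pi / 2 * I)) * f (-exp (p * (Real.pi * I))))
    (e₁ : ∀ p : ℂ, |p.re| < 1 → coshIntegral 1 (fun z => exp (p * z) * h₁ z) =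
        2 * Real.pi * exp (p * (Real.pi / 2 * I)) * f₁ (-exp (p * (Real.pi * I))))
    (e₂ : ∀ p : ℂ, |p.re| < 1 → coshIntegral 1 (fun z => exp (p * z) * h₂ z) =
        2 * Real.pi * exp (p * (Real.pi / 2 * I)) * f₂ (-exp (p * (Real.pi * I))))
    {p : ℂ} (hp : p ∈ cutStrip) :
    coshIntegral 3 (fun z => exp (p * z) * h z) =
      Real.pi * exp (p * (Real.pi / 2 * I)) * ((1 - p ^ 2) * f (-exp (p * (Real.pi * I))) -
        2 * p * f₁ (-exp (p * (Real.pi * I))) - f₂ (-exp (p * (Real.pi * I)))) := by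
  have hm : MapsTo (fun p : ℂ => -exp (p * (Real.pi * I))) cutStrip {z | 1 - z ∈ slitPlane} :=
    fun p hp => one_add_exp_mem_slitPlane hp
  have hde : DifferentiableOn ℂ (fun p : ℂ => -exp (p * (Real.pi * I))) cutStrip := by fun_prop
  have c := hf.comp hde hm
  have c₁ := hf₁.comp hde hm
  have c₂ := hf₂.comp hde hm
  have dL : DifferentiableOn ℂ (fun p => coshIntegral 3 (fun z => exp (p * z) * h z)) cutStrip :=
    fun p hp => (hh.differentiableAt_coshIntegral (n := 3)
      (by simpa using hp.1)).differentiableWithinAt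
  have dR : DifferentiableOn ℂ (fun p : ℂ => Real.pi * exp (p * (Real.pi / 2 * I)) *
      ((1 - p ^ 2) * f (-exp (p * (Real.pi * I))) - 2 * p * f₁ (-exp (p * (Real.pi * I))) -
        f₂ (-exp (p * (Real.pi * I))))) cutStrip := by
    refine DifferentiableOn.mul (by fun_prop) (DifferentiableOn.sub (DifferentiableOn.sub
      (DifferentiableOn.mul (by fun_prop) c) (DifferentiableOn.mul (by fun_prop) c₁)) c₂)
  refine (dL.analyticOnNhd isOpen_cutStrip).eqOn_of_preconnected_of_eventuallyEq
    (dR.analyticOnNhd isOpen_cutStrip) isPreconnected_cutStrip (z₀ := 0) ?_ ?_ hp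
  · simp [cutStrip]
  · have ho : IsOpen {p : ℂ | |p.re| < 1} := isOpen_lt (by fun_prop) continuous_const
    filter_upwards [ho.mem_nhds (show (0 : ℂ) ∈ {p : ℂ | |p.re| < 1} by simp)] with p hp
    have key := two_mul_coshIntegral_three hh hh₁ hh₂ hd hd₁ hp
    rw [e p hp, e₁ p hp, e₂ p hp] at key
    linear_combination key / 2

end ByParts

/-! ### Identification with the Hurwitz–Lerch and Hurwitz zeta functions. -/

section LerchPhi

open Filter Topology Complex

theorem isPreconnected_one_sub_slitPlane : IsPreconnected {z : ℂ | 1 - z ∈ slitPlane} := by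
  have e : {z : ℂ | 1 - z ∈ slitPlane} = (fun w : ℂ => 1 - w) '' slitPlane := by
    ext z
    simp only [mem_ofPred_eq, mem_image]
    exact ⟨fun h => ⟨1 - z, h, by ring⟩, by rintro ⟨w, hw, rfl⟩; simpa using hw⟩
  rw [e]
  exact ((starConvex_one_slitPlane.isPathConnected
    one_mem_slitPlane).isConnected.isPreconnected).image _ (by fun_prop)

theorem IsLerchContinuation.eqOn {s b : ℂ} {f g : ℂ → ℂ} (hf : IsLerchContinuation s b f)
    (hg : IsLerchContinuation s b g) : EqOn f g {z | 1 - z ∈ slitPlane} := by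
  refine (hf.1.analyticOnNhd isOpen_one_sub_slitPlane).eqOn_of_preconnected_of_eventuallyEq
    (hg.1.analyticOnNhd isOpen_one_sub_slitPlane) isPreconnected_one_sub_slitPlane (z₀ := 0)
    (by simp) ?_
  filter_upwards [Metric.ball_mem_nhds (0 : ℂ) one_pos] with z hz
  rw [mem_ball_zero_iff] at hz
  exact (hf.2 z hz).unique (hg.2 z hz)

theorem IsHurwitzContinuation.eqOn {b : ℂ} {f g : ℂ → ℂ} (hf : IsHurwitzContinuation b f)
    (hg : IsHurwitzContinuation b g) : EqOn f g {1}ᶜ := by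
  have ho : IsOpen ({1}ᶜ : Set ℂ) := isOpen_compl_singleton
  refine (hf.1.analyticOnNhd ho).eqOn_of_preconnected_of_eventuallyEq
    (hg.1.analyticOnNhd ho) (isConnected_compl_singleton_of_one_lt_rank (by simp) 1).isPreconnected
    (z₀ := 2) (by simp) ?_
  filter_upwards [(isOpen_lt continuous_const continuous_re).mem_nhds
    (show (2 : ℂ) ∈ {s : ℂ | 1 < s.re} by simp)] with s hs
  exact (hf.2 s hs).unique (hg.2 s hs)

/-- By uniqueness of the continuation, any one that is exhibited computes the value chosen by
`Classical.epsilon`. -/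
theorem IsLerchContinuation.lerchPhi_eq {s b z : ℂ} {f : ℂ → ℂ} (hf : IsLerchContinuation s b f)
    (hz : 1 - z ∈ slitPlane) : lerchPhi z s b = f z := by
  have h1 : z ≠ 1 := by rintro rfl; simp at hz
  rw [lerchPhi, if_neg h1, if_pos hz]
  exact (Classical.epsilon_spec (p := IsLerchContinuation s b) ⟨f, hf⟩).eqOn hf hz

theorem IsHurwitzContinuation.lerchPhi_eq {s b : ℂ} {g : ℂ → ℂ} (hg : IsHurwitzContinuation b g)
    (hs : s ≠ 1) : lerchPhi 1 s b = g s := by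
  rw [lerchPhi, if_pos rfl]
  exact (Classical.epsilon_spec (p := IsHurwitzContinuation b) ⟨g, hg⟩).eqOn hg hs

/-- The affine function which takes the value `b + n` at the `n`-th zero of `cosh`. -/
noncomputable def lerchBase (b z : ℂ) : ℂ := b - 1 / 2 - I * z / Real.pi

/-- The power which takes the value `(b + n) ^ κ` at the `n`-th zero of `cosh`. -/
noncomputable def lerchPow (b κ z : ℂ) : ℂ := lerchBase b z ^ κ

/-- The parameters for which `lerchPow b κ` is holomorphic in the upper half plane. -/
def LerchAdmissible (b κ : ℂ) : Prop := 1 / 2 ≤ b.re ∨ ∃ n : ℕ, κ = n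

theorem lerchBase_re (b z : ℂ) : (lerchBase b z).re = b.re - 1 / 2 + z.im / Real.pi := by
  rw [lerchBase, sub_re, sub_re, div_ofReal_re]
  simp
  ring

theorem lerchBase_im (b z : ℂ) : (lerchBase b z).im = b.im - z.re / Real.pi := by
  rw [lerchBase, sub_im, sub_im, div_ofReal_im]
  simp

theorem lerchBase_coshZero (b : ℂ) (n : ℕ) : lerchBase b (coshZero n) = b + n := by
  have : (Real.pi : ℂ) ≠ 0 := ofReal_ne_zero.2 Real.pi_pos.ne'
  rw [lerchBase, coshZero]
  field_simp
  linear_combination -(2 * (n : ℂ) + 1) * I_sq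

theorem lerchBase_add_nat_mul (b z : ℂ) (n : ℕ) :
    lerchBase b (z + n * (Real.pi * I)) = lerchBase (b + n) z := by
  have : (Real.pi : ℂ) ≠ 0 := ofReal_ne_zero.2 Real.pi_pos.ne'
  rw [lerchBase, lerchBase]
  field_simp
  linear_combination -(2 * (n : ℂ) * Real.pi) * I_sq

theorem hasDerivAt_lerchBase (b z : ℂ) : HasDerivAt (lerchBase b) (-I / Real.pi) z := by
  refine ((((hasDerivAt_id z).const_mul I).div_const (Real.pi : ℂ)).const_sub (b - 1 / 2)).congr_deriv ?_
  ring

theorem norm_lerchBase_le (b z : ℂ) : ‖lerchBase b z‖ ≤ ‖b - 1 / 2‖ + ‖z‖ := by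
  rw [lerchBase]
  refine (norm_sub_le _ _).trans (add_le_add_right ?_ _)
  rw [norm_div, norm_mul, norm_I, one_mul, norm_real, Real.norm_of_nonneg Real.pi_pos.le]
  exact div_le_self (norm_nonneg _) (by linarith [Real.pi_gt_three])

theorem hasDerivAt_lerchPow {b κ z : ℂ} (hb : LerchAdmissible b κ) (hz : 0 < z.im) :
    HasDerivAt (lerchPow b κ) (κ * (-I / Real.pi) * lerchPow b (κ - 1) z) z := by
  rcases hb with hb | ⟨n, rfl⟩
  · have hs : lerchBase b z ∈ slitPlane := by
      left
      rw [lerchBase_re]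
      have := div_pos hz Real.pi_pos
      linarith
    refine ((hasDerivAt_lerchBase b z).cpow_const (c := κ) hs).congr_deriv ?_
    rw [lerchPow]; ring
  · have e : lerchPow b n = fun z => lerchBase b z ^ n := by
      ext z; rw [lerchPow, cpow_natCast]
    rw [e]
    refine ((hasDerivAt_lerchBase b z).fun_pow n).congr_deriv ?_
    -- For `n = 0` the truncated exponent `n - 1` is harmless, as the factor `n` vanishes.
    rcases n with _ | n
    · simp
    · rw [lerchPow, Nat.cast_succ, add_sub_cancel_right, cpow_natCast, Nat.add_sub_cancel]
      ring

theorem exists_pow_lerchBase_le (b : ℂ) (M : ℕ) {δ : ℝ} (hδ : 0 < δ) :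
    ∃ C, 0 ≤ C ∧ ∀ z : ℂ, (1 + ‖lerchBase b z‖) ^ M ≤ C * Real.exp (δ * ‖z‖) := by
  refine ⟨M.factorial / δ ^ M * Real.exp (δ * (1 + ‖b - 1 / 2‖)), by positivity, fun z => ?_⟩
  have h1 := norm_lerchBase_le b z
  have h2 := Real.pow_div_factorial_le_exp (x := δ * (1 + ‖b - 1 / 2‖ + ‖z‖)) (by positivity) M
  rw [div_le_iff₀ (by positivity), mul_pow] at h2
  calc _ ≤ (1 + ‖b - 1 / 2‖ + ‖z‖) ^ M := pow_le_pow_left₀ (by positivity) (by linarith) M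
    _ ≤ Real.exp (δ * (1 + ‖b - 1 / 2‖ + ‖z‖)) * M.factorial / δ ^ M := by
      rw [le_div_iff₀ (by positivity)]; linarith
    _ = _ := by rw [mul_add δ (1 + _), Real.exp_add]; ring

theorem norm_cpow_le_of_ne_zero {w κ : ℂ} (hw : w ≠ 0) :
    ‖w ^ κ‖ ≤ Real.exp (Real.pi * |κ.im|) * ‖w‖ ^ κ.re := by
  refine (norm_cpow_le w κ).trans ?_
  rw [div_eq_mul_inv, ← Real.exp_neg, mul_comm]
  gcongr
  calc _ ≤ |arg w * κ.im| := neg_le_abs _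
    _ ≤ _ := by rw [abs_mul]; gcongr; exact abs_arg_le_pi w

theorem rpow_le_of_abs_le {a x r : ℝ} {M : ℕ} (ha : 0 < a) (hx : a ≤ x) (hr : |r| ≤ M) :
    x ^ r ≤ (1 + a⁻¹) ^ M * (1 + x) ^ M := by
  have hx0 : 0 < x := ha.trans_le hx
  have ha0 : 0 < a⁻¹ := inv_pos.2 ha
  have one : ∀ y : ℝ, 0 < y → (1 : ℝ) ≤ (1 + y) ^ M := fun y hy => one_le_pow₀ (by linarith)
  rcases le_total 0 r with h | h
  · rw [abs_of_nonneg h] at hr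
    calc x ^ r ≤ (1 + x) ^ r := Real.rpow_le_rpow hx0.le (by linarith) h
      _ ≤ (1 + x) ^ (M : ℝ) := Real.rpow_le_rpow_of_exponent_le (by linarith) hr
      _ = 1 * (1 + x) ^ M := by rw [Real.rpow_natCast, one_mul]
      _ ≤ _ := by gcongr; exact one _ ha0
  · rw [abs_of_nonpos h] at hr
    calc x ^ r ≤ a ^ r := Real.rpow_le_rpow_of_nonpos ha hx h
      _ = a⁻¹ ^ (-r) := by rw [Real.inv_rpow ha.le, Real.rpow_neg ha.le, inv_inv]
      _ ≤ (1 + a⁻¹) ^ (-r) := Real.rpow_le_rpow ha0.le (by linarith) (by linarith)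
      _ ≤ (1 + a⁻¹) ^ (M : ℝ) := Real.rpow_le_rpow_of_exponent_le (by linarith) hr
      _ = (1 + a⁻¹) ^ M * 1 := by rw [Real.rpow_natCast, mul_one]
      _ ≤ _ := by gcongr; exact one _ hx0

theorem norm_cpow_le_of_le_norm {a : ℝ} {w κ : ℂ} {M : ℕ} (ha : 0 < a) (hw : a ≤ ‖w‖)
    (hr : |κ.re| ≤ M) : ‖w ^ κ‖ ≤
      Real.exp (Real.pi * |κ.im|) * (1 + a⁻¹) ^ M * (1 + ‖w‖) ^ M := by
  refine (norm_cpow_le_of_ne_zero (norm_pos_iff.1 (ha.trans_le hw))).trans ?_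
  rw [mul_assoc]
  gcongr
  exact rpow_le_of_abs_le ha hw hr

theorem le_norm_lerchBase {b z : ℂ} (hb : 1 / 2 ≤ b.re) :
    z.im / Real.pi ≤ ‖lerchBase b z‖ := by
  refine le_trans ?_ (re_le_norm _)
  rw [lerchBase_re]; linarith

/-- If `Re b ≥ 1/2`, the base has norm at least `ε / π` on `Im z ≥ ε`, so even negative powers grow
at most polynomially; natural powers do so anyway. -/
theorem upperSubexp_lerchPow {b κ : ℂ} (hb : LerchAdmissible b κ) :
    UpperSubexp (lerchPow b κ) := by
  refine ⟨fun z hz => (hasDerivAt_lerchPow hb hz).differentiableAt.differentiableWithinAt,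
    fun ε hε δ hδ => ?_⟩
  rcases hb with hb | ⟨n, rfl⟩
  · obtain ⟨M, hM⟩ := exists_nat_ge |κ.re|
    obtain ⟨C, hC0, hC⟩ := exists_pow_lerchBase_le b M hδ
    refine ⟨Real.exp (Real.pi * |κ.im|) * (1 + (ε / Real.pi)⁻¹) ^ M * C, fun z hz => ?_⟩
    have ha : ε / Real.pi ≤ ‖lerchBase b z‖ := le_trans
      (div_le_div_of_nonneg_right hz Real.pi_pos.le) (le_norm_lerchBase hb)
    refine (norm_cpow_le_of_le_norm (div_pos hε Real.pi_pos) ha hM).trans ?_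
    rw [mul_assoc _ C]
    have : 0 < ε / Real.pi := div_pos hε Real.pi_pos
    gcongr
    exact hC z
  · obtain ⟨C, hC0, hC⟩ := exists_pow_lerchBase_le b n hδ
    refine ⟨C, fun z _ => le_trans ?_ (hC z)⟩
    rw [lerchPow, cpow_natCast, norm_pow]
    gcongr
    linarith

theorem UpperSubexp.const_mul {h : ℂ → ℂ} (hh : UpperSubexp h) (A : ℂ) :
    UpperSubexp fun z => A * h z := by
  refine ⟨hh.diff.const_mul A, fun ε hε δ hδ => ?_⟩
  obtain ⟨C, hC⟩ := hh.growth ε hε δ hδ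
  refine ⟨‖A‖ * C, fun z hz => ?_⟩
  rw [norm_mul, mul_assoc]
  gcongr
  exact hC z hz

theorem coshIntegral_const_mul (n : ℕ) (A : ℂ) (h : ℂ → ℂ) :
    coshIntegral n (fun z => A * h z) = A * coshIntegral n h := by
  rw [coshIntegral, coshIntegral, ← integral_const_mul]
  congr 1; ext u; ring

/-- The coefficient `A` is carried along because derivatives of a natural power may reach an
exponent that is not admissible, but only with coefficient `0`. -/
theorem exists_lerch_of_admissible {b κ A : ℂ} (hA : A = 0 ∨ LerchAdmissible b κ) :
    UpperSubexp (fun z => A * lerchPow b κ z) ∧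
    ∃ f : ℂ → ℂ, DifferentiableOn ℂ f {z | 1 - z ∈ slitPlane} ∧
      (∀ p : ℂ, |p.re| < 1 → coshIntegral 1 (fun z => exp (p * z) * (A * lerchPow b κ z)) =
        2 * Real.pi * exp (p * (Real.pi / 2 * I)) * f (-exp (p * (Real.pi * I)))) ∧
      ∀ z : ℂ, 1 - z ∈ slitPlane → f z = A * lerchPhi z (-κ) b := by
  rcases hA with rfl | hA
  · refine ⟨?_, fun _ => 0, differentiableOn_const _, fun p _ => ?_, fun z _ => by simp⟩
    · simp only [zero_mul]
      exact ⟨differentiableOn_const _, fun ε _ δ _ => ⟨0, by simp⟩⟩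
    · simp [coshIntegral]
  · have hh := upperSubexp_lerchPow hA
    obtain ⟨f, hd, hs, hp⟩ := hh.exists_lerch_continuation
    have hL : IsLerchContinuation (-κ) b f := by
      refine ⟨hd, fun z hz => ?_⟩
      convert hs z hz using 2 with n
      rw [lerchTerm, lerchPow, lerchBase_coshZero, neg_neg]
    refine ⟨hh.const_mul A, fun z => A * f z, hd.const_mul A, fun p hp' => ?_, fun z hz => ?_⟩
    · have : (fun z => exp (p * z) * (A * lerchPow b κ z)) =
          fun z => A * (exp (p * z) * lerchPow b κ z) := by ext z; ring
      rw [this, coshIntegral_const_mul, hp p hp']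
      ring
    · rw [hL.lerchPhi_eq hz]

/-- Translation by `πi` replaces `b` by `b + 1`; the double pole at `iπ/2`, where the base equals
`b`, contributes the derivative of the power. -/
theorem coshIntegral_two_lerchPow_shift {b κ : ℂ} (hb : LerchAdmissible b κ) :
    coshIntegral 2 (lerchPow b κ) =
      coshIntegral 2 (lerchPow (b + 1) κ) - 2 * κ * b ^ (κ - 1) := by
  have hπ := Real.pi_pos
  have hh := upperSubexp_lerchPow hb
  obtain ⟨C, hC⟩ := hh.growth (Real.pi / 4) (by positivity) (1 / 2) (by norm_num)
  have hC0 : 0 ≤ C := by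
    have := (norm_nonneg _).trans (hC (Real.pi / 4 * I) (by simp))
    exact nonneg_of_mul_nonneg_left this (Real.exp_pos _)
  have key := coshIntegral_two_sub_shift (hh.diff.mono fun z hz => hz.1)
    (C := C * Real.exp (1 / 2 * (5 * Real.pi / 4))) (α := 1 / 2) (by norm_num) (by norm_num)
    (fun z hz => (hC z hz.1).trans ?_)
  · have e1 : (fun z => lerchPow b κ (z + Real.pi * I)) = lerchPow (b + 1) κ := by
      ext z
      have := lerchBase_add_nat_mul b z 1
      rw [Nat.cast_one, one_mul] at this
      rw [lerchPow, this, lerchPow]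
    have e2 : lerchBase b (Real.pi / 2 * I) = b := by
      have := lerchBase_coshZero b 0
      rw [coshZero, Nat.cast_zero, add_zero, zero_add] at this
      rw [← this]; congr 1; ring
    have e3 : deriv (lerchPow b κ) (Real.pi / 2 * I) = κ * (-I / Real.pi) * b ^ (κ - 1) := by
      rw [(hasDerivAt_lerchPow hb (by rw [pi_div_two_mul_I_im]; positivity)).deriv, lerchPow, e2]
    rw [e1, e3] at key
    have : (Real.pi : ℂ) ≠ 0 := ofReal_ne_zero.2 hπ.ne'
    field_simp at key
    linear_combination key + 2 * κ * b ^ (κ - 1) * I_sq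
  · rw [mul_assoc, ← Real.exp_add]
    refine mul_le_mul_of_nonneg_left (Real.exp_le_exp.2 ?_) hC0
    have h1 := norm_le_abs_re_add_abs_im z
    rw [abs_of_nonneg (by linarith [hz.1] : 0 ≤ z.im)] at h1
    linarith [hz.2]

theorem coshIntegral_two_lerchPow_eq_sum {b κ : ℂ} (hb : 1 / 2 ≤ b.re) (N : ℕ) :
    coshIntegral 2 (lerchPow b κ) = coshIntegral 2 (lerchPow (b + N) κ) -
      2 * κ * ∑ n ∈ Finset.range N, (b + n) ^ (κ - 1) := by
  induction N with
  | zero => simp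
  | succ N ih =>
    rw [ih, coshIntegral_two_lerchPow_shift (b := b + N), Finset.sum_range_succ, Nat.cast_succ,
      add_assoc b]
    · ring
    · left
      rw [add_re, natCast_re]
      linarith [(Nat.cast_nonneg N : (0 : ℝ) ≤ N)]

theorem summable_add_nat_cpow {b s : ℂ} (hb : 1 / 2 ≤ b.re) (hs : 1 < s.re) :
    Summable fun n : ℕ => (b + n) ^ (-s) := by
  refine summable_of_isBigO_nat (Real.summable_nat_rpow.2 (show -s.re < -1 by linarith)) ?_
  refine Asymptotics.IsBigO.of_bound (Real.exp (Real.pi * |(-s).im|)) ?_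
  filter_upwards [eventually_gt_atTop 0] with n hn
  have hn' : (0 : ℝ) < n := Nat.cast_pos.2 hn
  have h1 : (n : ℝ) ≤ ‖b + n‖ := by
    refine le_trans ?_ (re_le_norm _)
    rw [add_re, natCast_re]; linarith
  refine (norm_cpow_le_of_ne_zero (norm_pos_iff.1 (hn'.trans_le h1))).trans ?_
  rw [Real.norm_of_nonneg (by positivity), neg_re]
  gcongr ?_ * ?_
  exact Real.rpow_le_rpow_of_nonpos hn' h1 (by linarith)

/-- The shift relation telescopes. The integral for `b + N` tends to `0`, as its base has norm at
least `N` and its exponent `1 - s` has negative real part. -/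
theorem hasSum_coshIntegral_two {b s : ℂ} (hb : 1 / 2 ≤ b.re) (hs : 1 < s.re) :
    HasSum (fun n : ℕ => (b + n) ^ (-s))
      (coshIntegral 2 (lerchPow b (1 - s)) / (2 * (s - 1))) := by
  have hπ := Real.pi_pos
  have hs1 : s - 1 ≠ 0 := fun h => by
    rw [sub_eq_zero] at h; rw [h, one_re] at hs; exact lt_irrefl _ hs
  rw [(summable_add_nat_cpow hb hs).hasSum_iff_tendsto_nat]
  obtain ⟨K, hK⟩ := norm_coshIntegral_le (n := 2) (α := 0) (by norm_num)
  have hR : Tendsto (fun N : ℕ => coshIntegral 2 (lerchPow (b + N) (1 - s))) atTop (𝓝 0) := by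
    refine squeeze_zero_norm' (a := fun N : ℕ => Real.exp (Real.pi * |(1 - s).im|) *
      (N : ℝ) ^ (-(s.re - 1)) * K) ?_ ?_
    · filter_upwards [eventually_gt_atTop 0] with N hN
      refine hK _ _ fun u => ?_
      have hN' : (0 : ℝ) < N := Nat.cast_pos.2 hN
      have h1 : (N : ℝ) ≤ ‖lerchBase (b + N) (u + (Real.pi / 4 : ℝ) * I)‖ := by
        refine le_trans ?_ (re_le_norm _)
        rw [lerchBase_re, add_re, natCast_re]
        have : (0 : ℝ) ≤ (u + (Real.pi / 4 : ℝ) * I : ℂ).im / Real.pi := by simp; positivity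
        linarith
      rw [zero_mul, Real.exp_zero, mul_one]
      refine (norm_cpow_le_of_ne_zero (norm_pos_iff.1 (hN'.trans_le h1))).trans ?_
      gcongr ?_ * ?_
      rw [show (1 - s).re = -(s.re - 1) by simp]
      exact Real.rpow_le_rpow_of_nonpos hN' h1 (by linarith)
    · have := (((tendsto_rpow_neg_atTop (sub_pos.2 hs)).comp tendsto_natCast_atTop_atTop).const_mul
        (Real.exp (Real.pi * |(1 - s).im|))).mul_const K
      simpa using this
  have hlim := ((tendsto_const_nhds (x := coshIntegral 2 (lerchPow b (1 - s)))).sub hR).div_const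
    (2 * (s - 1))
  rw [sub_zero] at hlim
  refine hlim.congr fun N => ?_
  rw [coshIntegral_two_lerchPow_eq_sum hb N, show (1 - s - 1 : ℂ) = -s by ring]
  field_simp
  ring

theorem differentiable_coshIntegral_two {b : ℂ} (hb : 1 / 2 ≤ b.re) :
    Differentiable ℂ fun κ => coshIntegral 2 (lerchPow b κ) := by
  intro κ
  have hπ := Real.pi_pos
  -- The added `1` makes `M` bound the real part of every exponent in the unit ball about `κ`.
  obtain ⟨M, hM⟩ := exists_nat_ge (|κ.re| + 1)
  obtain ⟨C, hC0, hC⟩ := exists_pow_lerchBase_le b M one_pos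
  have him : ∀ u : ℝ, (u + (Real.pi / 4 : ℝ) * I : ℂ).im = Real.pi / 4 := fun u => by simp
  have hlow : ∀ u : ℝ, (1 / 4 : ℝ) ≤ ‖lerchBase b (u + (Real.pi / 4 : ℝ) * I)‖ := fun u => by
    refine le_trans (le_of_eq ?_) (le_norm_lerchBase hb)
    rw [him]; field_simp
  have hbd : ∀ u : ℝ, ∀ κ' ∈ Metric.ball κ 1, ‖lerchPow b κ' (u + (Real.pi / 4 : ℝ) * I)‖ ≤
      Real.exp (Real.pi * (|κ.im| + 1)) * (1 + (1 / 4 : ℝ)⁻¹) ^ M *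
        (C * Real.exp (Real.pi / 4)) * Real.exp (1 * |u|) := fun u κ' hκ => by
    rw [Metric.mem_ball, dist_eq_norm] at hκ
    have h1 := (abs_re_le_norm (κ' - κ)).trans hκ.le
    have h2 := (abs_im_le_norm (κ' - κ)).trans hκ.le
    rw [sub_re] at h1
    rw [sub_im] at h2
    have h3 := abs_sub_abs_le_abs_sub κ'.re κ.re
    have h4 := abs_sub_abs_le_abs_sub κ'.im κ.im
    refine (norm_cpow_le_of_le_norm (by norm_num) (hlow u) (by linarith : |κ'.re| ≤ M)).trans ?_
    rw [mul_assoc _ (C * _)]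
    gcongr
    · linarith
    · refine (hC _).trans ?_
      rw [mul_assoc, ← Real.exp_add]
      gcongr
      have h5 := norm_le_abs_re_add_abs_im (u + (Real.pi / 4 : ℝ) * I : ℂ)
      rw [him, abs_of_pos (by positivity : 0 < Real.pi / 4),
        show (u + (Real.pi / 4 : ℝ) * I : ℂ).re = u by simp] at h5
      linarith
  refine differentiableAt_integral_of_locally_dominated one_pos
    (B := fun u => Real.exp (Real.pi * (|κ.im| + 1)) * (1 + (1 / 4 : ℝ)⁻¹) ^ M *
        (C * Real.exp (Real.pi / 4)) * (2 / |Real.cos (Real.pi / 4)|) ^ 2 *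
      Real.exp (-(((2 : ℕ) - 1) * |u|))) (fun κ' hκ => ?_) (fun u => ?_) ?_ fun u κ' hκ => ?_
  · have := (upperSubexp_lerchPow (b := b) (κ := κ') (Or.inl hb)).integrable_base (p := 0) (n := 2)
      (by norm_num)
    simp only [zero_mul, exp_zero, one_mul] at this
    exact this.aestronglyMeasurable
  · have hne : lerchBase b (u + (Real.pi / 4 : ℝ) * I) ≠ 0 :=
      norm_pos_iff.1 (lt_of_lt_of_le (by norm_num) (hlow u))
    refine DifferentiableOn.mul (fun κ' _ => ?_) (differentiableOn_const _)
    exact (differentiableAt_id.const_cpow (Or.inl hne)).differentiableWithinAt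
  · exact (integrable_exp_neg_mul_abs (by norm_num)).const_mul _
  · exact norm_mul_inv_cosh_pow_le 2 Real.cos_pi_div_four_ne_zero (hbd u κ' hκ)

theorem lerchTerm_one (s b : ℂ) : lerchTerm 1 s b = fun n : ℕ => (b + n) ^ (-s) := by
  ext n; rw [lerchTerm, one_pow, one_mul]

theorem isHurwitzContinuation_of_half_le {b : ℂ} (hb : 1 / 2 ≤ b.re) :
    IsHurwitzContinuation b fun s => coshIntegral 2 (lerchPow b (1 - s)) / (2 * (s - 1)) := by
  refine ⟨fun s hs => DifferentiableAt.differentiableWithinAt ?_, fun s hs => ?_⟩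
  · refine DifferentiableAt.div ?_ (by fun_prop)
      (mul_ne_zero two_ne_zero (sub_ne_zero.2 hs))
    exact (differentiable_coshIntegral_two hb (1 - s)).comp s (by fun_prop)
  · rw [lerchTerm_one]; exact hasSum_coshIntegral_two hb hs

theorem IsHurwitzContinuation.of_add_one {b : ℂ} (hb : b ≠ 0) {g : ℂ → ℂ}
    (hg : IsHurwitzContinuation (b + 1) g) :
    IsHurwitzContinuation b fun s => b ^ (-s) + g s := by
  refine ⟨DifferentiableOn.add (fun s _ => ?_) hg.1, fun s hs => ?_⟩
  · exact (differentiableAt_id.neg.const_cpow (Or.inl hb)).differentiableWithinAt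
  · have := hg.2 s hs
    rw [lerchTerm_one] at this ⊢
    rw [← hasSum_nat_add_iff' 1, Finset.sum_range_one, Nat.cast_zero, add_zero, add_sub_cancel_left]
    have e : ∀ n : ℕ, b + (n + 1 : ℕ) = b + 1 + n := fun n => by push_cast; ring
    simpa only [e] using this

/-- For `Re b < 1/2` both sides are reduced to `b + 1`: the integral by the shift relation, the zeta
function by splitting off its first term. -/
theorem coshIntegral_two_lerchPow_eq {b κ : ℂ} (hb : LerchAdmissible b κ) (hb' : -(1 / 2) ≤ b.re)
    (hb0 : b ≠ 0) (hκ : κ ≠ 0) :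
    coshIntegral 2 (lerchPow b κ) = -2 * κ * lerchPhi 1 (1 - κ) b := by
  have h1 : 1 - κ ≠ 1 := by simpa using hκ
  rcases le_or_gt (1 / 2) b.re with h | h
  · rw [(isHurwitzContinuation_of_half_le h).lerchPhi_eq h1, sub_sub_cancel]
    field_simp
    ring
  · have hb1 : 1 / 2 ≤ (b + 1).re := by rw [add_re, one_re]; linarith
    rw [((isHurwitzContinuation_of_half_le hb1).of_add_one hb0).lerchPhi_eq h1,
      coshIntegral_two_lerchPow_shift hb, sub_sub_cancel, neg_sub]
    field_simp
    ring

end LerchPhi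

/-! ### Passage from the line of height `π/4` to the real line. -/

section RealLine

open Filter Topology Complex

/-- The base can vanish in the closed strip for `Re b = 1/2`, at the real point `π Im b`; for `Re k
< 0` this is a singularity of order `Re k > -1`. The bound is uniform in the height, as dominated
convergence demands. -/
theorem exists_lerchPow_strip_bound {b k : ℂ}
    (hk : (∃ n : ℕ, k = n) ∨ (1 / 2 ≤ b.re ∧ (b.re = 1 / 2 → -1 < k.re))) {δ : ℝ} (hδ : 0 < δ) :
    ∃ C r : ℝ, 0 ≤ C ∧ -1 < r ∧ r ≤ 0 ∧ ∀ u : ℝ, u ≠ Real.pi * b.im →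
      ∀ η ∈ Icc 0 (Real.pi / 4), ‖lerchPow b k (u + η * I)‖ ≤
        C * (Real.exp (δ * |u|) + |u - Real.pi * b.im| ^ r) := by
  have hπ := Real.pi_pos
  have him : ∀ u η : ℝ, (u + η * I : ℂ).im = η := fun u η => by simp
  have hre : ∀ u η : ℝ, (u + η * I : ℂ).re = u := fun u η => by simp
  have hlow : ∀ u η : ℝ, |u - Real.pi * b.im| / Real.pi ≤ ‖lerchBase b (u + η * I)‖ := by
    intro u η
    refine le_trans (le_of_eq ?_) (abs_im_le_norm _)
    rw [lerchBase_im, hre, ← abs_neg (b.im - _), ← abs_of_pos hπ, ← abs_div, abs_of_pos hπ]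
    congr 1
    field_simp
    ring
  have hne : ∀ u η : ℝ, u ≠ Real.pi * b.im → lerchBase b (u + η * I) ≠ 0 := fun u η hu =>
    norm_pos_iff.1 ((div_pos (abs_pos.2 (sub_ne_zero.2 hu)) hπ).trans_le (hlow u η))
  have poly : (∃ (C : ℝ) (M : ℕ), 0 ≤ C ∧ ∀ u : ℝ, u ≠ Real.pi * b.im → ∀ η ∈ Icc 0 (Real.pi / 4),
      ‖lerchPow b k (u + η * I)‖ ≤ C * (1 + ‖lerchBase b (u + η * I)‖) ^ M) →
      ∃ C r : ℝ, 0 ≤ C ∧ -1 < r ∧ r ≤ 0 ∧ ∀ u : ℝ, u ≠ Real.pi * b.im →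
      ∀ η ∈ Icc 0 (Real.pi / 4), ‖lerchPow b k (u + η * I)‖ ≤
        C * (Real.exp (δ * |u|) + |u - Real.pi * b.im| ^ r) := by
    rintro ⟨C, M, hC0, hC⟩
    obtain ⟨D, hD0, hD⟩ := exists_pow_lerchBase_le b M hδ
    refine ⟨C * D * Real.exp (δ * (Real.pi / 4)), 0, by positivity, by norm_num, le_rfl,
      fun u hu η hη => ?_⟩
    have h1 : ‖(u + η * I : ℂ)‖ ≤ |u| + Real.pi / 4 := by
      have := norm_le_abs_re_add_abs_im (u + η * I : ℂ)
      rw [him, hre, abs_of_nonneg hη.1] at this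
      linarith [hη.2]
    calc _ ≤ C * (1 + ‖lerchBase b (u + η * I)‖) ^ M := hC u hu η hη
      _ ≤ C * (D * Real.exp (δ * (|u| + Real.pi / 4))) := by
        gcongr
        exact (hD _).trans (by gcongr)
      _ = C * D * Real.exp (δ * (Real.pi / 4)) * Real.exp (δ * |u|) := by
        rw [mul_add, Real.exp_add]; ring
      _ ≤ _ := by
        gcongr
        rw [Real.rpow_zero]
        linarith
  rcases hk with ⟨n, rfl⟩ | ⟨hb, hbk⟩
  · refine poly ⟨1, n, zero_le_one, fun u _ η _ => ?_⟩
    rw [lerchPow, cpow_natCast, norm_pow, one_mul]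
    exact pow_le_pow_left₀ (norm_nonneg _) (by linarith) n
  rcases hb.eq_or_lt with hb' | hb'
  · rcases le_or_gt 0 k.re with h0 | h0
    · obtain ⟨M, hM⟩ := exists_nat_ge k.re
      refine poly ⟨Real.exp (Real.pi * |k.im|), M, by positivity, fun u hu η _ => ?_⟩
      refine (norm_cpow_le_of_ne_zero (hne u η hu)).trans ?_
      gcongr
      calc _ ≤ (1 + ‖lerchBase b (u + η * I)‖) ^ k.re :=
            Real.rpow_le_rpow (norm_nonneg _) (by linarith) h0
        _ ≤ (1 + ‖lerchBase b (u + η * I)‖) ^ (M : ℝ) :=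
            Real.rpow_le_rpow_of_exponent_le (by linarith [norm_nonneg (lerchBase b (u + η * I))]) hM
        _ = _ := Real.rpow_natCast _ _
    · refine ⟨Real.exp (Real.pi * |k.im|) * (Real.pi ^ k.re)⁻¹, k.re, by positivity,
        hbk hb'.symm, h0.le, fun u hu η _ => ?_⟩
      refine (norm_cpow_le_of_ne_zero (hne u η hu)).trans ?_
      rw [mul_assoc]
      gcongr
      have h1 := Real.rpow_le_rpow_of_nonpos (div_pos (abs_pos.2 (sub_ne_zero.2 hu)) hπ)
        (hlow u η) h0.le
      rw [Real.div_rpow (abs_nonneg _) hπ.le, div_eq_inv_mul] at h1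
      refine h1.trans ?_
      gcongr
      linarith [Real.exp_pos (δ * |u|)]
  · obtain ⟨M, hM⟩ := exists_nat_ge |k.re|
    have ha : 0 < b.re - 1 / 2 := by linarith
    refine poly ⟨Real.exp (Real.pi * |k.im|) * (1 + (b.re - 1 / 2)⁻¹) ^ M, M, by positivity,
      fun u _ η hη => ?_⟩
    refine norm_cpow_le_of_le_norm ha (le_trans ?_ (re_le_norm _)) hM
    rw [lerchBase_re, him]
    linarith [div_nonneg hη.1 hπ.le]

theorem integrable_exp_add_abs_rpow {δ β r : ℝ} (hδ : 0 < δ) (hβ : δ < β) (hr : -1 < r) (hr0 : r ≤ 0)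
    (x₀ : ℝ) :
    Integrable fun u : ℝ => (Real.exp (δ * |u|) + |u - x₀| ^ r) * Real.exp (-(β * |u|)) := by
  set g : ℝ → ℝ := (Ioc 0 1).indicator fun x => x ^ r with hg
  have hgi : Integrable g := by
    rw [hg, integrable_indicator_iff measurableSet_Ioc]
    exact (intervalIntegrable_iff_integrableOn_Ioc_of_le zero_le_one).1
      (intervalIntegral.intervalIntegrable_rpow' hr)
  have hg0 : ∀ x, 0 ≤ g x := fun x => indicator_nonneg (fun y hy => Real.rpow_nonneg hy.1.le r) x
  have hb : Integrable fun u : ℝ => g (u - x₀) + g (-(u - x₀)) + Real.exp (-(β * |u|)) :=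
    ((hgi.comp_sub_right x₀).add (hgi.comp_neg.comp_sub_right x₀)).add
      (integrable_exp_neg_mul_abs (hδ.trans hβ))
  have h2 : Integrable fun u : ℝ => |u - x₀| ^ r * Real.exp (-(β * |u|)) := by
    refine hb.mono' (Measurable.aestronglyMeasurable (by fun_prop)) (Eventually.of_forall fun u => ?_)
    have hp : 0 ≤ |u - x₀| ^ r := Real.rpow_nonneg (abs_nonneg _) r
    have he : Real.exp (-(β * |u|)) ≤ 1 := Real.exp_le_one_iff.2
      (by have := abs_nonneg u; have := hδ.trans hβ; nlinarith [mul_nonneg this.le (abs_nonneg u)])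
    have he0 := Real.exp_pos (-(β * |u|))
    rw [Real.norm_of_nonneg (mul_nonneg hp he0.le)]
    have a1 := hg0 (u - x₀)
    have a2 := hg0 (-(u - x₀))
    have small : |u - x₀| ^ r ≤ 1 → |u - x₀| ^ r * Real.exp (-(β * |u|)) ≤
        g (u - x₀) + g (-(u - x₀)) + Real.exp (-(β * |u|)) := fun h => by nlinarith
    rcases le_or_gt |u - x₀| 1 with h1 | h1
    · rcases lt_trichotomy (u - x₀) 0 with h | h | h
      · have : g (-(u - x₀)) = |u - x₀| ^ r := by
          rw [abs_of_neg h] at h1 ⊢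
          exact indicator_of_mem (show -(u - x₀) ∈ Ioc 0 1 from ⟨by linarith, h1⟩) _
        nlinarith
      -- At `u = x₀` the conventional value of `0 ^ r` is `1` or `0`, hence at most `1`.
      · apply small
        rw [h, abs_zero]
        rcases hr0.eq_or_lt with h0 | h0
        · rw [h0, Real.rpow_zero]
        · rw [Real.zero_rpow h0.ne]; exact zero_le_one
      · have : g (u - x₀) = |u - x₀| ^ r := by
          rw [abs_of_pos h] at h1 ⊢
          exact indicator_of_mem (show u - x₀ ∈ Ioc 0 1 from ⟨h, h1⟩) _
        nlinarith
    · exact small (Real.rpow_le_one_of_one_le_of_nonpos h1.le hr0)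
  refine ((integrable_exp_neg_mul_abs (sub_pos.2 hβ)).add h2).congr (Eventually.of_forall fun u => ?_)
  simp only [Pi.add_apply]
  rw [add_mul, ← Real.exp_add]
  ring_nf

theorem UpperSubexp.integral_line_eq {h : ℂ → ℂ} (hh : UpperSubexp h) {p : ℂ} (hp : |p.re| < 3)
    {η : ℝ} (hη : 0 < η) (hη' : η ≤ Real.pi / 4) :
    ∫ u : ℝ, exp (p * (u + η * I)) * h (u + η * I) * (cosh (u + η * I))⁻¹ ^ 3 =
      coshIntegral 3 fun z => exp (p * z) * h z := by
  have hπ := Real.pi_pos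
  have hcos : ∀ y ∈ Icc η (Real.pi / 4), Real.cos y ≠ 0 := fun y hy =>
    (Real.cos_pos_of_mem_Ioo ⟨by linarith [hy.1], by linarith [hy.2]⟩).ne'
  have hp3 : |p.re| < (3 : ℕ) := by exact_mod_cast hp
  set δ := (3 - |p.re|) / 2 with hδ
  have hδ0 : 0 < δ := by rw [hδ]; linarith
  obtain ⟨C, hC0, hC⟩ := hh.exp_mul_bound hη hδ0
  -- The factor `64` is the cube of the `4` in the bound for `1 / cosh`; as `δ` is half the gap `3 -
  -- |Re p|`, a decay of rate `δ` remains.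
  refine integral_line_eq_of_differentiableOn
    (f := fun z => exp (p * z) * h z * (cosh z)⁻¹ ^ 3) hη' ?_ ?_ ?_
    (tendsto_const_mul_exp_neg_mul (C * Real.exp (|δ - p.im| * (Real.pi / 4)) * 64) hδ0) ?_
  · refine DifferentiableOn.mul ((hh.differentiableOn_exp_mul p).mono fun z hz => ?_)
      (DifferentiableOn.pow (differentiable_cosh.differentiableOn.inv fun z hz => ?_) 3)
    · exact hη.trans_le hz.1
    · have := cosh_add_mul_I_ne_zero (hcos z.im hz) z.re
      rwa [re_add_im] at this
  · exact hh.integrable_line hp3 hη (hcos _ ⟨le_rfl, hη'⟩)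
  · exact hh.integrable_line hp3 (hη.trans_le hη') (hcos _ ⟨hη', le_rfl⟩)
  · filter_upwards [eventually_ge_atTop 1] with R hR u hu y hy
    have h1 := norm_mul_inv_cosh_le_of_one_le (w := 1) (y := y) (hu ▸ hR : 1 ≤ |u|)
    rw [one_mul, norm_one, mul_one] at h1
    have h2 := hC p (u + y * I) (by simpa using hy.1)
    rw [show (u + y * I : ℂ).im = y by simp, show (u + y * I : ℂ).re = u by simp] at h2
    have h3 : Real.exp ((δ - p.im) * y) ≤ Real.exp (|δ - p.im| * (Real.pi / 4)) := by
      have hy0 : 0 ≤ y := hη.le.trans hy.1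
      exact Real.exp_le_exp.2 (mul_le_mul (le_abs_self _) hy.2 hy0 (abs_nonneg _))
    rw [norm_mul, norm_pow]
    calc _ ≤ C * Real.exp (|δ - p.im| * (Real.pi / 4)) * Real.exp ((|p.re| + δ) * |u|) *
          (4 * Real.exp (-|u|)) ^ 3 := by
          refine mul_le_mul (h2.trans ?_) (pow_le_pow_left₀ (norm_nonneg _) h1 3) (by positivity)
            (by positivity)
          gcongr
      _ = _ := by
        rw [mul_pow, ← Real.exp_nat_mul, mul_mul_mul_comm, ← Real.exp_add, hu, mul_assoc _ 64,
          mul_assoc, mul_assoc, hδ]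
        norm_num
        ring_nf

/-- The integrals at heights `η` in `(0, π/4]` all agree, and dominated convergence allows `η → 0`;
pointwise convergence can fail only at `u = π Im b`, a null set. -/
theorem integral_real_line_eq {b k p : ℂ}
    (hk : (∃ n : ℕ, k = n) ∨ (1 / 2 ≤ b.re ∧ (b.re = 1 / 2 → -1 < k.re))) (hp : |p.re| < 3) :
    Integrable (fun u : ℝ => exp (p * u) * lerchPow b k u * (cosh u)⁻¹ ^ 3) ∧
    ∫ u : ℝ, exp (p * u) * lerchPow b k u * (cosh u)⁻¹ ^ 3 =
      coshIntegral 3 fun z => exp (p * z) * lerchPow b k z := by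
  have hπ := Real.pi_pos
  have hadm : LerchAdmissible b k := hk.elim Or.inr fun h => Or.inl h.1
  have hh := upperSubexp_lerchPow hadm
  have hp3 : |p.re| < (3 : ℕ) := by exact_mod_cast hp
  set δ := (3 - |p.re|) / 2 with hδ
  have hδ0 : 0 < δ := by rw [hδ]; linarith
  have hδ3 : δ < 3 - |p.re| := by linarith
  obtain ⟨C, r, hC0, hr, hr0, hC⟩ := exists_lerchPow_strip_bound hk hδ0
  set F : ℝ → ℝ → ℂ := fun η u =>
    exp (p * (u + η * I)) * lerchPow b k (u + η * I) * (cosh (u + η * I))⁻¹ ^ 3 with hF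
  set B : ℝ → ℝ := fun u => Real.exp (|p.im| * (Real.pi / 4)) * C * (2 / (1 / 2)) ^ 3 *
    ((Real.exp (δ * |u|) + |u - Real.pi * b.im| ^ r) * Real.exp (-((3 - |p.re|) * |u|))) with hB
  have hBi : Integrable B := (integrable_exp_add_abs_rpow hδ0 hδ3 hr hr0 _).const_mul _
  have hcos : ∀ η ∈ Icc 0 (Real.pi / 4), 1 / 2 ≤ Real.cos η := fun η hη => by
    rw [← Real.cos_pi_div_three]
    exact Real.cos_le_cos_of_nonneg_of_le_pi hη.1 (by linarith) (by linarith [hη.2])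
  have hFB : ∀ u : ℝ, u ≠ Real.pi * b.im → ∀ η ∈ Icc 0 (Real.pi / 4), ‖F η u‖ ≤ B u := by
    intro u hu η hη
    have hc := hcos η hη
    have hc0 : 0 < Real.cos η := by linarith
    have h1 := norm_inv_cosh_le hc0.ne' u
    rw [abs_of_pos hc0] at h1
    have h1' : ‖(cosh (u + η * I))⁻¹‖ ≤ 2 / (1 / 2) * Real.exp (-|u|) := h1.trans (by gcongr)
    have h2 : ‖exp (p * (u + η * I))‖ ≤
        Real.exp (|p.im| * (Real.pi / 4)) * Real.exp (|p.re| * |u|) := by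
      rw [norm_exp, ← Real.exp_add]
      refine Real.exp_le_exp.2 ?_
      have e : (p * (u + η * I)).re = -(p.im * η) + p.re * u := by simp; ring
      rw [e]
      refine add_le_add ?_ (by rw [← abs_mul]; exact le_abs_self _)
      refine (neg_le_abs _).trans ?_
      rw [abs_mul, abs_of_nonneg hη.1]
      exact mul_le_mul_of_nonneg_left hη.2 (abs_nonneg _)
    have h3 := hC u hu η hη
    have hr' : 0 ≤ |u - Real.pi * b.im| ^ r := Real.rpow_nonneg (abs_nonneg _) r
    rw [hF]
    simp only
    rw [norm_mul, norm_mul, norm_pow]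
    calc _ ≤ Real.exp (|p.im| * (Real.pi / 4)) * Real.exp (|p.re| * |u|) *
          (C * (Real.exp (δ * |u|) + |u - Real.pi * b.im| ^ r)) *
          (2 / (1 / 2) * Real.exp (-|u|)) ^ 3 := by gcongr
      _ = B u := by
        rw [hB]
        simp only
        have e : Real.exp (-((3 - |p.re|) * |u|)) =
            Real.exp (|p.re| * |u|) * Real.exp (-|u|) ^ 3 := by
          rw [← Real.exp_nat_mul, ← Real.exp_add]; push_cast; ring_nf
        rw [e, mul_pow]
        ring
  have hae : ∀ᵐ u : ℝ, u ≠ Real.pi * b.im := by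
    simp [ae_iff, measure_singleton]
  have hmem : ∀ᶠ η in 𝓝[>] (0 : ℝ), η ∈ Ioc 0 (Real.pi / 4) :=
    Ioc_mem_nhdsGT (by positivity)
  have hmeas : ∀ η ∈ Ioc 0 (Real.pi / 4), AEStronglyMeasurable (F η) := fun η hη =>
    (hh.integrable_line hp3 hη.1
      (by linarith [hcos η ⟨hη.1.le, hη.2⟩] : 0 < Real.cos η).ne').aestronglyMeasurable
  have hlim : ∀ᵐ u : ℝ, Tendsto (fun η => F η u) (𝓝[>] 0) (𝓝 (F 0 u)) := by
    filter_upwards [hae] with u hu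
    have hs : lerchBase b (u + (0 : ℝ) * I) ∈ slitPlane := by
      right
      rw [lerchBase_im]
      intro h0
      apply hu
      simp only [ofReal_zero, zero_mul, add_zero, ofReal_re] at h0
      field_simp at h0
      linarith
    have hcont : ContinuousAt (fun η : ℝ => F η u) 0 := by
      have e : ContinuousAt (fun η : ℝ => (u + η * I : ℂ)) 0 := by fun_prop
      have e1 : ContinuousAt (fun z => lerchBase b z) (u + (0 : ℝ) * I) :=
        (hasDerivAt_lerchBase b _).continuousAt
      have e2 : ContinuousAt (fun η : ℝ => lerchPow b k (u + η * I)) 0 :=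
        ContinuousAt.comp (f := fun η : ℝ => (u + η * I : ℂ)) (g := lerchPow b k) (x := 0)
          (e1.cpow continuousAt_const hs) e
      have e3 : ContinuousAt (fun η : ℝ => cosh (u + η * I)) 0 :=
        continuous_cosh.continuousAt.comp e
      refine ContinuousAt.mul (ContinuousAt.mul (by fun_prop) e2) ((e3.inv₀ ?_).pow 3)
      exact cosh_add_mul_I_ne_zero (by simp) u
    exact hcont.tendsto.mono_left nhdsWithin_le_nhds
  have hF0 : F 0 = fun u : ℝ => exp (p * u) * lerchPow b k u * (cosh u)⁻¹ ^ 3 := by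
    ext u; simp [hF]
  have hm0 : AEStronglyMeasurable (F 0) := by
    have hev : ∀ n : ℕ, Real.pi / 4 * (1 / ((n : ℝ) + 1)) ∈ Ioc 0 (Real.pi / 4) := fun n => by
      refine ⟨by positivity, mul_le_of_le_one_right (by positivity) ?_⟩
      rw [div_le_one (by positivity)]; linarith [(Nat.cast_nonneg n : (0 : ℝ) ≤ n)]
    refine aestronglyMeasurable_of_tendsto_ae atTop
      (f := fun (n : ℕ) => F (Real.pi / 4 * (1 / ((n : ℝ) + 1)))) (fun n => hmeas _ (hev n)) ?_
    filter_upwards [hlim] with u hu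
    refine hu.comp (tendsto_nhdsWithin_iff.2 ⟨?_, Eventually.of_forall fun n => (hev n).1⟩)
    simpa using (tendsto_one_div_add_atTop_nhds_zero_nat (𝕜 := ℝ)).const_mul (Real.pi / 4)
  rw [← hF0]
  refine ⟨hBi.mono' hm0 ?_, ?_⟩
  · filter_upwards [hae] with u hu using hFB u hu 0 ⟨le_rfl, by positivity⟩
  · have key := tendsto_integral_filter_of_dominated_convergence (l := 𝓝[>] (0 : ℝ)) B
      (F := F) (f := F 0) (by filter_upwards [hmem] with η hη using hmeas η hη)
      (by
        filter_upwards [hmem] with η hη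
        filter_upwards [hae] with u hu using hFB u hu η ⟨hη.1.le, hη.2⟩) hBi hlim
    refine tendsto_nhds_unique key (tendsto_const_nhds.congr' ?_)
    filter_upwards [hmem] with η hη
    exact (hh.integral_line_eq hp hη.1 hη.2).symm

end RealLine

/-! ### The substitution `x = e^u` and the evaluation of the logarithmic integral. -/

section LogIntegral

open Complex

theorem I_mul_pi_cpow (k : ℂ) :
    (I * Real.pi : ℂ) ^ k = exp (1 / 2 * I * Real.pi * k) * (Real.pi : ℂ) ^ k := by
  have hπ := Real.pi_pos
  have h0 : (Real.pi : ℂ) ≠ 0 := ofReal_ne_zero.2 hπ.ne'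
  rw [cpow_def_of_ne_zero (mul_ne_zero I_ne_zero h0), cpow_def_of_ne_zero h0,
    log_mul_ofReal _ hπ _ I_ne_zero, log_I, ofReal_log hπ.le, ← exp_add]
  congr 1
  ring

/-- The arguments of `iπ` and `w` add up to a value in `[0, π]`, so the principal logarithm is
additive, even on the boundary of the half plane. -/
theorem I_mul_pi_mul_cpow {w : ℂ} (hw : 0 ≤ w.re) (k : ℂ) :
    (I * Real.pi * w) ^ k = (I * Real.pi) ^ k * w ^ k := by
  have hπ := Real.pi_pos
  have h0 : (Real.pi : ℂ) ≠ 0 := ofReal_ne_zero.2 hπ.ne'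
  have h1 : (I * Real.pi : ℂ) ≠ 0 := mul_ne_zero I_ne_zero h0
  rcases eq_or_ne w 0 with rfl | hw0
  · rcases eq_or_ne k 0 with rfl | hk
    · simp
    · rw [mul_zero, zero_cpow hk, mul_zero]
  · have ha : arg (I * Real.pi) = Real.pi / 2 := by rw [arg_mul_real hπ, arg_I]
    have hb := abs_le.1 (abs_arg_le_pi_div_two_iff.2 hw)
    have hl : log (I * Real.pi * w) = log (I * Real.pi) + log w :=
      (log_mul_eq_add_log_iff h1 hw0).2 ⟨by rw [ha]; linarith, by rw [ha]; linarith⟩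
    rw [cpow_def_of_ne_zero (mul_ne_zero h1 hw0), cpow_def_of_ne_zero h1, cpow_def_of_ne_zero hw0,
      hl, ← exp_add, add_mul]

/-- The parameter `b` of the Hurwitz–Lerch function that belongs to `a`. -/
noncomputable def lerchParam (a : ℂ) : ℂ := 1 / 2 - I * log a / Real.pi

theorem lerchParam_re (a : ℂ) : (lerchParam a).re = 1 / 2 + a.arg / Real.pi := by
  rw [lerchParam, sub_re, div_ofReal_re]
  simp [log_im]
  ring

theorem lerchParam_ne_zero {a : ℂ} (ha : a ≠ 0) (haI : a ≠ -I) : lerchParam a ≠ 0 := by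
  intro h
  apply haI
  have h0 : (Real.pi : ℂ) ≠ 0 := ofReal_ne_zero.2 Real.pi_pos.ne'
  have hl : log a = -(Real.pi / 2 * I) := by
    rw [lerchParam] at h
    field_simp at h
    linear_combination (I / 2) * h + log a * I_sq
  rw [← exp_log ha, hl, exp_neg, exp_pi_div_two_mul_I, inv_I]

theorem I_mul_pi_mul_lerchBase (a z : ℂ) :
    I * Real.pi * lerchBase (lerchParam a) z = log a + z := by
  have h0 : (Real.pi : ℂ) ≠ 0 := ofReal_ne_zero.2 Real.pi_pos.ne'
  rw [lerchBase, lerchParam]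
  field_simp
  linear_combination -(2 * (log a + z)) * I_sq

theorem log_add_cpow {a k : ℂ} (hk : (∃ n : ℕ, k = n) ∨ 0 ≤ a.arg) (u : ℝ) :
    (log a + u) ^ k = (I * Real.pi) ^ k * lerchPow (lerchParam a) k u := by
  rw [← I_mul_pi_mul_lerchBase, lerchPow]
  rcases hk with ⟨n, rfl⟩ | hk
  · simp only [cpow_natCast, mul_pow]
  · refine I_mul_pi_mul_cpow ?_ k
    rw [lerchBase_re, lerchParam_re, ofReal_im, zero_div]
    have := div_nonneg hk Real.pi_pos.le
    linarith

/-- With `x = e^u` one has `x² + 1 = 2 e^u cosh u`. Its cube yields the `8` and, together with `dx =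
e^u du`, lowers `m` to `m - 2`. -/
theorem exp_smul_logIntegrand_exp {m k a : ℂ} (ha : a ≠ 0)
    (hk : (∃ n : ℕ, k = n) ∨ 0 ≤ a.arg) (u : ℝ) :
    |Real.exp u| • logIntegrand m k a (Real.exp u) =
      (I * Real.pi) ^ k / 8 *
        (exp ((m - 2) * u) * lerchPow (lerchParam a) k u * (cosh u)⁻¹ ^ 3) := by
  have hu := Real.exp_pos u
  have hc : cosh u ≠ 0 := by rw [← ofReal_cosh]; exact ofReal_ne_zero.2 (Real.cosh_pos u).ne'
  have e1 : log (a * (Real.exp u : ℝ)) = log a + u := by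
    rw [log_mul_ofReal _ hu _ ha, Real.log_exp, add_comm]
  have e2 : ((Real.exp u : ℝ) : ℂ) ^ m = exp (m * u) := by
    rw [cpow_def_of_ne_zero (ofReal_ne_zero.2 hu.ne'), ← ofReal_log hu.le, Real.log_exp, mul_comm]
  have e3 : ((Real.exp u : ℝ) : ℂ) ^ 2 + 1 = exp u * (2 * cosh u) := by
    rw [ofReal_exp, two_cosh, mul_add, ← exp_add, ← exp_add, add_neg_cancel, exp_zero, sq,
      ← exp_add]
  have e4 : exp (m * u) = exp ((m - 2) * u) * exp u ^ 2 := by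
    rw [← exp_nat_mul, ← exp_add]; congr 1; push_cast; ring
  rw [abs_of_pos hu, logIntegrand, e1, e2, e3, log_add_cpow hk, e4, real_smul, ofReal_exp]
  have := exp_ne_zero (u : ℂ)
  field_simp
  ring

theorem integral_logIntegrand {m k a : ℂ} (hm : -1 < m.re) (hm' : m.re < 5) (ha : a ≠ 0)
    (hak : (∃ n : ℕ, k = n) ∨ (0 ≤ a.arg ∧ (a.arg = 0 → -1 < k.re))) :
    IntegrableOn (logIntegrand m k a) (Ioi 0) ∧
    ∫ x in Ioi (0 : ℝ), logIntegrand m k a x = (I * Real.pi) ^ k / 8 *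
      coshIntegral 3 fun z => exp ((m - 2) * z) * lerchPow (lerchParam a) k z := by
  have hπ := Real.pi_pos
  have hp : |(m - 2).re| < 3 := by
    rw [sub_re, show (2 : ℂ).re = 2 from rfl, abs_lt]; constructor <;> linarith
  have hb : (∃ n : ℕ, k = n) ∨ (1 / 2 ≤ (lerchParam a).re ∧
      ((lerchParam a).re = 1 / 2 → -1 < k.re)) := by
    refine hak.imp_right fun h => ?_
    rw [lerchParam_re]
    refine ⟨by linarith [div_nonneg h.1 hπ.le], fun h0 => h.2 ?_⟩
    have : a.arg / Real.pi = 0 := by linarith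
    exact (div_eq_zero_iff.1 this).resolve_right hπ.ne'
  have hk : (∃ n : ℕ, k = n) ∨ 0 ≤ a.arg := hak.imp_right And.left
  obtain ⟨hi, he⟩ := integral_real_line_eq hb hp
  have him : Real.exp '' univ = Ioi 0 := by rw [image_univ, Real.range_exp]
  have hd : ∀ x ∈ univ, HasDerivWithinAt Real.exp (Real.exp x) univ x := fun x _ =>
    (Real.hasDerivAt_exp x).hasDerivWithinAt
  constructor
  · rw [← him, integrableOn_image_iff_integrableOn_abs_deriv_smul MeasurableSet.univ hd
      Real.exp_injective.injOn, integrableOn_univ]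
    simp only [exp_smul_logIntegrand_exp ha hk]
    exact hi.const_mul _
  · rw [← him, integral_image_eq_integral_abs_deriv_smul MeasurableSet.univ hd
      Real.exp_injective.injOn, setIntegral_univ, ← he, ← integral_const_mul]
    simp only [exp_smul_logIntegrand_exp ha hk]

theorem LerchAdmissible.sub_one {b k : ℂ} (h : LerchAdmissible b k) :
    k = 0 ∨ LerchAdmissible b (k - 1) := by
  rcases h with h | ⟨n, rfl⟩
  · exact Or.inr (Or.inl h)
  · rcases n with _ | n
    · left; simp
    · right; right; exact ⟨n, by push_cast; ring⟩

theorem coshIntegral_three_lerchPow {b k p : ℂ} (hb : LerchAdmissible b k) (hp : p ∈ cutStrip) :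
    coshIntegral 3 (fun z => exp (p * z) * lerchPow b k z) =
      Real.pi * exp (p * (Real.pi / 2 * I)) *
        ((1 - p ^ 2) * lerchPhi (-exp (p * (Real.pi * I))) (-k) b -
          2 * p * (k * (-I / Real.pi) * lerchPhi (-exp (p * (Real.pi * I))) (1 - k) b) -
          k * (-I / Real.pi) * ((k - 1) * (-I / Real.pi)) *
            lerchPhi (-exp (p * (Real.pi * I))) (2 - k) b) := by
  have hA₁ : k * (-I / Real.pi) = 0 ∨ LerchAdmissible b (k - 1) :=
    hb.sub_one.imp_left fun h => by rw [h, zero_mul]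
  have hA₂ : k * (-I / Real.pi) * ((k - 1) * (-I / Real.pi)) = 0 ∨ LerchAdmissible b (k - 2) := by
    rcases hA₁ with h | h
    · left; rw [h, zero_mul]
    · rcases h.sub_one with h | h
      · left; rw [h, zero_mul, mul_zero]
      · right; rwa [sub_sub, one_add_one_eq_two] at h
  obtain ⟨u₀, f, d, e, l⟩ := exists_lerch_of_admissible (A := 1) (Or.inr hb)
  obtain ⟨u₁, f₁, d₁, e₁, l₁⟩ := exists_lerch_of_admissible hA₁
  obtain ⟨u₂, f₂, d₂, e₂, l₂⟩ := exists_lerch_of_admissible hA₂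
  simp only [one_mul] at u₀ e l
  have hz := one_add_exp_mem_slitPlane hp
  rw [coshIntegral_three_eq u₀ u₁ u₂ (fun z hz => hasDerivAt_lerchPow hb hz) (fun z hz => ?_)
    d d₁ d₂ e e₁ e₂ hp, l _ hz, l₁ _ hz, l₂ _ hz, neg_sub, neg_sub]
  rcases hA₁ with h | h
  · simp only [h, zero_mul]
    exact hasDerivAt_const z 0
  · refine ((hasDerivAt_lerchPow h hz).const_mul (k * (-I / Real.pi))).congr_deriv ?_
    rw [sub_sub, one_add_one_eq_two]
    ring

theorem coshIntegral_three_lerchPow_of_sq_eq_one {b k p : ℂ} (hb : LerchAdmissible b k)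
    (hb' : -(1 / 2) ≤ b.re) (hb0 : b ≠ 0) (hk : k ≠ 0) (hk1 : k ≠ 1) (hp : p = 1 ∨ p = -1) :
    coshIntegral 3 (fun z => exp (p * z) * lerchPow b k z) =
      -2 * k * lerchPhi 1 (1 - k) b +
        p / 2 * (k * (-I / Real.pi) * (-2 * (k - 1) * lerchPhi 1 (2 - k) b)) := by
  have hb₁ := hb.sub_one.resolve_left hk
  rw [coshIntegral_three_of_sq_eq_one (upperSubexp_lerchPow hb)
    ((upperSubexp_lerchPow hb₁).const_mul (k * (-I / Real.pi)))
    (fun z hz => hasDerivAt_lerchPow hb hz) hp, coshIntegral_const_mul,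
    coshIntegral_two_lerchPow_eq hb hb' hb0 hk,
    coshIntegral_two_lerchPow_eq hb₁ hb' hb0 (sub_ne_zero.2 hk1),
    show 1 - (k - 1) = 2 - k by ring]

end LogIntegral

theorem theorem3p1 (m k a : ℂ)
    -- the strip of convergence, and `-exp (iπm)` off the branch cut `(1, ∞)` of `Φ`
    (hm : -1 < m.re) (hm' : m.re < 5)
    (hcut : m.re = 1 ∨ m.re = 3 → 0 ≤ m.im)
    -- for `m = 1, 3` (where `-exp (iπm) = 1`) all the zeta values that occur are defined
    (hpole : m = 1 ∨ m = 3 → k ≠ 0 ∧ k ≠ 1 ∧ a ≠ -Complex.I)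
    (ha : a ≠ 0)
    -- the principal power `log(ax) ^ k` has no branch problem and is locally integrable
    (hak : (∃ n : ℕ, k = n) ∨ (0 ≤ a.arg ∧ (a.arg = 0 → -1 < k.re))) :
    IntegrableOn (logIntegrand m k a) (Ioi (0 : ℝ)) ∧
    ∫ x in Ioi (0 : ℝ), logIntegrand m k a x =
      1 / 8 * (Real.pi : ℂ) ^ (k - 1) * Complex.exp (1 / 2 * Complex.I * Real.pi * (k + m)) *
        (-2 * Complex.I * Real.pi * k * (m - 2) *
            lerchPhi (-Complex.exp (Complex.I * m * Real.pi)) (1 - k)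
              (1 / 2 - Complex.I * Complex.log a / Real.pi)
          - (k - 1) * k *
            lerchPhi (-Complex.exp (Complex.I * m * Real.pi)) (2 - k)
              (1 / 2 - Complex.I * Complex.log a / Real.pi)
          + (Real.pi : ℂ) ^ 2 * (m - 3) * (m - 1) *
            lerchPhi (-Complex.exp (Complex.I * m * Real.pi)) (-k)
              (1 / 2 - Complex.I * Complex.log a / Real.pi)) := by
  have hπ := Real.pi_pos
  have h0 : (Real.pi : ℂ) ≠ 0 := Complex.ofReal_ne_zero.2 hπ.ne'
  obtain ⟨hi, he⟩ := integral_logIntegrand hm hm' ha hak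
  refine ⟨hi, ?_⟩
  have hb : LerchAdmissible (lerchParam a) k := by
    refine hak.symm.imp (fun h => ?_) id
    rw [lerchParam_re]
    linarith [div_nonneg h.1 hπ.le]
  have hpow : (Real.pi : ℂ) ^ (k - 1) = (Real.pi : ℂ) ^ k / Real.pi := by
    rw [Complex.cpow_sub _ _ h0, Complex.cpow_one]
  have hexp : Complex.exp (1 / 2 * Complex.I * Real.pi * (k + m)) =
      Complex.exp (1 / 2 * Complex.I * Real.pi * k) * Complex.exp (Real.pi / 2 * Complex.I * m) := by
    rw [← Complex.exp_add]; congr 1; ring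
  rw [he, I_mul_pi_cpow, hpow, hexp]
  change _ = 1 / 8 * _ * _ * (-2 * Complex.I * Real.pi * k * (m - 2) *
      lerchPhi (-Complex.exp (Complex.I * m * Real.pi)) (1 - k) (lerchParam a) -
    (k - 1) * k * lerchPhi (-Complex.exp (Complex.I * m * Real.pi)) (2 - k) (lerchParam a) +
    (Real.pi : ℂ) ^ 2 * (m - 3) * (m - 1) *
      lerchPhi (-Complex.exp (Complex.I * m * Real.pi)) (-k) (lerchParam a))
  by_cases hm13 : m = 1 ∨ m = 3
  · obtain ⟨hk, hk1, haI⟩ := hpole hm13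
    -- For natural `k` the argument of `a` may be negative, but it exceeds `-π`, so one shift of `b`
    -- by `1` always suffices.
    have hb' : -(1 / 2) ≤ (lerchParam a).re := by
      rw [lerchParam_re]
      have : -1 ≤ a.arg / Real.pi := by
        rw [le_div_iff₀ hπ]; linarith [Complex.neg_pi_lt_arg a]
      linarith
    have hp : m - 2 = 1 ∨ m - 2 = -1 := by
      rcases hm13 with rfl | rfl <;> norm_num
    have hz : -Complex.exp (Complex.I * m * Real.pi) = 1 := by
      rcases hm13 with rfl | rfl
      · rw [mul_one, mul_comm, Complex.exp_pi_mul_I, neg_neg]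
      · rw [show Complex.I * 3 * Real.pi = Real.pi * Complex.I + 2 * Real.pi * Complex.I by ring,
          Complex.exp_add, Complex.exp_pi_mul_I, Complex.exp_two_pi_mul_I, mul_one, neg_neg]
    have hE : Complex.exp (Real.pi / 2 * Complex.I * m) = -(m - 2) * Complex.I := by
      rcases hm13 with rfl | rfl
      · rw [mul_one, Complex.exp_pi_div_two_mul_I]; ring
      · rw [show Real.pi / 2 * Complex.I * 3 =
            Real.pi / 2 * Complex.I + Real.pi * Complex.I by ring,
          Complex.exp_add, Complex.exp_pi_div_two_mul_I, Complex.exp_pi_mul_I]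
        ring
    have hm2 : (m - 2) * (m - 2) = 1 := by rcases hm13 with rfl | rfl <;> norm_num
    have hm3 : (m - 3) * (m - 1) = 0 := by rcases hm13 with rfl | rfl <;> norm_num
    rw [coshIntegral_three_lerchPow_of_sq_eq_one hb hb' (lerchParam_ne_zero ha haI) hk hk1 hp, hz,
      hE, mul_assoc _ (m - 3), hm3]
    generalize lerchPhi 1 (1 - k) (lerchParam a) = X
    generalize lerchPhi 1 (2 - k) (lerchParam a) = Y
    field_simp
    have hI := Complex.I_sq
    linear_combination (-2 * (m - 2) ^ 2 * k * Real.pi * X) * hI + 2 * Real.pi * k * X * hm2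
  -- On the lines `Re m = 1, 3` only `Im m ≥ 0` is allowed, and `Im m = 0` is the case already
  -- treated.
  · have hp : m - 2 ∈ cutStrip := by
      refine ⟨?_, ?_⟩
      · rw [Complex.sub_re, show (2 : ℂ).re = 2 from rfl, abs_lt]; constructor <;> linarith
      · by_contra! hcon
        obtain ⟨h1, h2⟩ := hcon
        rw [Complex.sub_im, show (2 : ℂ).im = 0 from rfl, sub_zero] at h1
        rw [Complex.sub_re, show (2 : ℂ).re = 2 from rfl] at h2
        have h3 : m.re = 1 ∨ m.re = 3 := by
          rcases eq_or_eq_neg_of_abs_eq h2 with h | h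
          · right; linarith
          · left; linarith
        have h4 : m.im = 0 := le_antisymm h1 (hcut h3)
        exact hm13 (h3.imp (fun h => Complex.ext (by simpa using h) (by simpa using h4))
          fun h => Complex.ext (by simpa using h) (by simpa using h4))
    have hz : Complex.exp ((m - 2) * (Real.pi * Complex.I)) =
        Complex.exp (Complex.I * m * Real.pi) := by
      rw [show (m - 2) * (Real.pi * Complex.I) =
        Complex.I * m * Real.pi - 2 * Real.pi * Complex.I by ring, Complex.exp_sub,
        Complex.exp_two_pi_mul_I, div_one]
    have hE : Complex.exp ((m - 2) * (Real.pi / 2 * Complex.I)) =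
        -Complex.exp (Real.pi / 2 * Complex.I * m) := by
      rw [show (m - 2) * (Real.pi / 2 * Complex.I) =
        Real.pi / 2 * Complex.I * m - Real.pi * Complex.I by ring, Complex.exp_sub,
        Complex.exp_pi_mul_I, div_neg, div_one]
    rw [coshIntegral_three_lerchPow hb hp, hz, hE]
    generalize lerchPhi _ (1 - k) (lerchParam a) = X
    generalize lerchPhi _ (2 - k) (lerchParam a) = Y
    generalize lerchPhi _ (-k) (lerchParam a) = Z
    have hI := Complex.I_sq
    field_simp
    linear_combination (k * (k - 1) * Y) * hI
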